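/- **Proposition (Hölder regularity of $II$).** Let $0\le\gamma<1$ and let $\beta:[0,\pi/2]\to[0,\infty)$ be measurable, not almost everywhere zero, with $\beta(\theta)\le C\cos\theta\sin\theta$. Consider the cross section $B(|V|,\theta)=|V|^{\gamma}\beta(\theta)$, where $\theta$ is the angle between the relative velocity $V=\zeta_*-\zeta$ and the unit vector $\alpha$ in the collision rule $\zeta'=\zeta+(\alpha\cdot V)\alpha$, $\zeta_*'=\zeta_*-(\alpha\cdot V)\alpha$. Let $L=-\nu+K$ be the Boltzmann collision operator with this cross section, linearized around the Maxwellian $\mathcal M=\pi^{-3/2}e^{-|\zeta|^2}$ (perturbation $F=\mathcal M+\mathcal M^{1/2}f$) and normalized so that $$\nu(|\zeta|)=\beta_0\int_{\mathbb R^3}e^{-|\eta|^2}|\eta-\zeta|^{\gamma}\,d\eta,\qquad \beta_0=\int_0^{\pi/2}\beta(\theta)\,d\theta ,$$ and let $k(\zeta,\zeta_*)$ be the kernel of the integral operator $K$, $Kf(\zeta)=\int_{\mathbb R^3} k(\zeta,\zeta_*)f(\zeta_*)\,d\zeta_*$. Let $\Omega\subset\mathbb R^3$ be a bounded convex open set with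 $C^1$ boundary and outer unit normal $n$, and put $\Gamma_-=\{(X,\zeta): X\in\partial\Omega,\ \zeta\in\mathbb R^3,\ \zeta\cdot n(X)<0\}$. For $x\in\Omega$ and $\zeta\in\mathbb R^3$ let $\tau_-(x,\zeta)\in(0,\infty]$ be the first time at which the backward trajectory $s\mapsto x-s\zeta$ touches $\partial\Omega$ (so $\tau_-(x,0)=\infty$), and for $\zeta\ne0$ let $p(x,\zeta)=x-\tau_-(x,\zeta)\zeta$. Define $$II(x,\zeta)=\int_0^{\tau_-(x,\zeta)}\!\int_{\mathbb R^3}e^{-\nu(|\zeta|)s}\,k(\zeta,\zeta')\,e^{-\nu(|\zeta'|)\tau_-(x-s\zeta,\zeta')}\,f\big(p(x-s\zeta,\zeta'),\zeta'\big)\,d\zeta'\,ds .$$ Let $0<\sigma<\frac12$ and let $A,M$ be real numbers. Then there is a constant $C_{10}$, depending only on $A$, $M$, $\sigma$, $\Omega$ and the potential $(\gamma,\beta)$, such that the following holds for every real-valued $f$ satisfying, for all $(X,\zeta),(Y,\zeta')\in\Gamma_-$, $$|f(X,\zeta)|\le A,\qquad |f(X,\zeta)-f(Y,\zeta')|\le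 M\big(|X-Y|^2+|\zeta-\zeta'|^2\big)^{\sigma/2}$$ (for example for bounded $f$ with $\|f\|_{L^\infty_{x,\zeta}}\le A$, the supremum including the boundary values on $\Gamma_-$). For all $x\in\Omega$, $\zeta\in\mathbb R^3$ the integral defining $II(x,\zeta)$ converges absolutely (its integrand is integrable in $(s,\zeta')$), and for all $x,y\in\Omega$ and $\zeta_1,\zeta_2\in\mathbb R^3$, $$|II(x,\zeta_1)-II(y,\zeta_2)|\le C_{10}\,(1+d_0^{-1})^{3}\,\big(|x-y|^2+|\zeta_1-\zeta_2|^2\big)^{\sigma/2},$$ where $d_0=\min\{d(x,\partial\Omega),d(y,\partial\Omega)\}$. -/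

import Mathlib

open MeasureTheory Set Filter Topology
open scoped ENNReal NNReal

noncomputable section

namespace LinBoltzmann

/-- Physical space and velocity space: `ℝ³` with its Euclidean norm. -/
abbrev E3 : Type := EuclideanSpace ℝ (Fin 3)

/-! ### Domains with `C¹` boundary -/

/-- `ρ` is a local `C¹` defining function of `Ω` at `X`: near `X` the set `Ω` is `{ρ < 0}`,
and the gradient of `ρ` at `X` does not vanish. -/
structure IsLocalDefiningFunction (Ω : Set E3) (X : E3) (ρ : E3 → ℝ) : Prop where
  contDiffAt : ContDiffAt ℝ 1 ρ X
  gradient_ne : gradient ρ X ≠ 0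
  eventually_iff : ∀ᶠ z in 𝓝 X, z ∈ Ω ↔ ρ z < 0

/-- The boundary of `Ω` is of class `C¹`. -/
def HasC1Boundary (Ω : Set E3) : Prop :=
  ∀ X ∈ frontier Ω, ∃ ρ : E3 → ℝ, IsLocalDefiningFunction Ω X ρ

/-- `n` is the outer unit normal of `Ω` at the boundary point `X`. -/
def IsOuterNormal (Ω : Set E3) (X n : E3) : Prop :=
  ∃ ρ : E3 → ℝ, IsLocalDefiningFunction Ω X ρ ∧ n = ‖gradient ρ X‖⁻¹ • gradient ρ X

/-- The incoming boundary phase space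
`Γ₋ = {(X, ζ) : X ∈ ∂Ω, ζ · n(X) < 0}`. -/
def incoming (Ω : Set E3) : Set (E3 × E3) :=
  {q | q.1 ∈ frontier Ω ∧ ∃ n : E3, IsOuterNormal Ω q.1 n ∧ inner ℝ q.2 n < 0}

/-! ### The collision frequency and the collision kernel

The cross section is `B(|V|, θ) = |V|^γ β(θ)`, where `V = ζ_* - ζ` and `θ ∈ [0, π/2]` is the
angle between `V` and the unit vector `α` in the collision rule
`ζ' = ζ + (α·V) α`, `ζ_*' = ζ_* - (α·V) α`. -/

/-- The angular factor of a (nontrivial) cutoff cross section: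
`0 ≤ β(θ) ≤ C cos θ sin θ` on `[0, π/2]`, and `β` is not almost everywhere zero there. -/
structure IsCutoffAngular (β : ℝ → ℝ) : Prop where
  measurable : Measurable β
  nonneg : ∀ θ ∈ Icc (0 : ℝ) (Real.pi / 2), 0 ≤ β θ
  bound : ∃ C : ℝ, ∀ θ ∈ Icc (0 : ℝ) (Real.pi / 2), β θ ≤ C * (Real.cos θ * Real.sin θ)
  nontrivial : 0 < ∫ θ in (0 : ℝ)..(Real.pi / 2), β θ

/-- `β₀ = ∫₀^{π/2} β(θ) dθ`. -/
def betaZero (β : ℝ → ℝ) : ℝ := ∫ θ in (0 : ℝ)..(Real.pi / 2), β θ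

/-- The collision frequency `ν(|ζ|) = β₀ ∫ e^{-|η|²} |η - ζ|^γ dη`. -/
def nu (γ : ℝ) (β : ℝ → ℝ) (ζ : E3) : ℝ :=
  betaZero β * ∫ η : E3, Real.exp (-‖η‖ ^ 2) * ‖η - ζ‖ ^ γ

/-- The kernel of the loss part of `K`:
`k₁(ζ, ζ_*) = β₀ |ζ - ζ_*|^γ e^{-(|ζ|² + |ζ_*|²)/2}`. -/
def kernelLoss (γ : ℝ) (β : ℝ → ℝ) (ζ ζs : E3) : ℝ :=
  betaZero β * ‖ζ - ζs‖ ^ γ * Real.exp (-(‖ζ‖ ^ 2 + ‖ζs‖ ^ 2) / 2)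

/-- The length of the component of `ζ` orthogonal to `v`. -/
def orthLength (ζ v : E3) : ℝ := ‖ζ - (inner ℝ ζ v / ‖v‖ ^ 2) • v‖

/-- The kernel `k₂(ζ, η)` of the gain part of `K` (Grad's reduction of the gain integral), i.e.
the kernel of
`f ↦ (2π)⁻¹ ∫∫∫ e^{-|ζ_*|²/2} (e^{-|ζ'|²/2} f(ζ_*') + e^{-|ζ_*'|²/2} f(ζ'))
      |ζ_* - ζ|^γ β(θ) dθ dε dζ_*`.

Since `θ ↦ π/2 - θ` exchanges `ζ'` and `ζ_*'`, the two summands combine into a single one with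
`f(ζ')` and with `β(θ) + β(π/2 - θ)` in place of `β(θ)`.
Write `ζ' = η = ζ + v` and `ζ_*' = ζ + w`, `w ⊥ v`, so that `ζ_* = η + w`,
`|ζ_* - ζ| = |v| / cos θ`, `|w| = |v| tan θ`, and
`dθ dε dζ_* = (sin θ)⁻¹ |v|⁻² dw dη` with `dw = |v|² tan θ (cos θ)⁻² dθ dε` in polar
coordinates of the plane `v^⊥`. With `a` the length of the component of `ζ` orthogonal to `v`
and `ε` the angle in that plane between this component and `w`,
`(|ζ_*|² + |ζ_*'|²)/2 = (|v|² + (|η|² - |ζ|²)²/|v|²)/4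
   + a² + 2 a |v| tan θ cos ε + |v|² tan² θ`. -/
def kernelGain (γ : ℝ) (β : ℝ → ℝ) (ζ η : E3) : ℝ :=
  (2 * Real.pi)⁻¹ * ‖η - ζ‖ ^ γ
    * Real.exp (-(‖η - ζ‖ ^ 2 + ((‖η‖ ^ 2 - ‖ζ‖ ^ 2) / ‖η - ζ‖) ^ 2) / 4)
    * ∫ θ in (0 : ℝ)..(Real.pi / 2), ∫ ε in (0 : ℝ)..(2 * Real.pi),
        (β θ + β (Real.pi / 2 - θ)) * Real.cos θ ^ (-(3 + γ))
          * Real.exp (-(orthLength ζ (η - ζ) ^ 2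
              + 2 * orthLength ζ (η - ζ) * (‖η - ζ‖ * Real.tan θ) * Real.cos ε
              + (‖η - ζ‖ * Real.tan θ) ^ 2))

/-- The collision kernel `k(ζ, ζ_*)`: the linearized collision operator about the standard
Maxwellian (for the perturbation `F = 𝓜 + 𝓜^{1/2} f`, `𝓜 = π^{-3/2} e^{-|ζ|²}`, normalized so
that the collision frequency is `nu`) is `L f = -ν f + K f` with
`K f (ζ) = ∫ k(ζ, ζ_*) f(ζ_*) dζ_*`. -/
def collisionKernel (γ : ℝ) (β : ℝ → ℝ) (ζ ζs : E3) : ℝ :=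
  kernelGain γ β ζ ζs - kernelLoss γ β ζ ζs

/-! ### Backward trajectories and the iterated boundary terms -/

/-- `τ₋(x, ζ)`: the time at which the backward trajectory `s ↦ x - s ζ` touches `∂Ω`
(`∞` if it never does, that is, for `ζ = 0` when `x ∈ Ω` and `Ω` is bounded). -/
def tauMinus (Ω : Set E3) (x ζ : E3) : ℝ≥0∞ :=
  ⨅ (s : ℝ≥0) (_ : x - (s : ℝ) • ζ ∈ frontier Ω), (s : ℝ≥0∞)

/-- `p(x, ζ)`: the boundary point touched by the backward trajectory
(meaningful when `τ₋(x, ζ) < ∞`). -/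
def exitPoint (Ω : Set E3) (x ζ : E3) : E3 := x - (tauMinus Ω x ζ).toReal • ζ

open Classical in
/-- The boundary term `I(x, ζ) = f(p(x, ζ), ζ) e^{-ν(|ζ|) τ₋(x, ζ)}`, with `e^{-∞} = 0`. -/
def termI (γ : ℝ) (β : ℝ → ℝ) (Ω : Set E3) (f : E3 → E3 → ℝ) (x ζ : E3) : ℝ :=
  if tauMinus Ω x ζ = ∞ then 0
  else f (exitPoint Ω x ζ) ζ * Real.exp (-(nu γ β ζ * (tauMinus Ω x ζ).toReal))

/-- The times `0 < s < τ₋(x, ζ)`. -/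
def flightTimes (Ω : Set E3) (x ζ : E3) : Set ℝ :=
  {s : ℝ | 0 < s ∧ ENNReal.ofReal s < tauMinus Ω x ζ}

/-- The integrand
`e^{-ν(|ζ|) s} k(ζ, ζ') e^{-ν(|ζ'|) τ₋(x - ζ s, ζ')} f(p(x - ζ s, ζ'), ζ')` of `II`. -/
def integrandII (γ : ℝ) (β : ℝ → ℝ) (Ω : Set E3) (f : E3 → E3 → ℝ) (x ζ : E3)
    (s : ℝ) (ζ' : E3) : ℝ :=
  Real.exp (-(nu γ β ζ * s)) * collisionKernel γ β ζ ζ' * termI γ β Ω f (x - s • ζ) ζ'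

/-- The once-iterated boundary term
`II(x, ζ) = ∫₀^{τ₋(x, ζ)} ∫ e^{-ν(|ζ|) s} k(ζ, ζ') e^{-ν(|ζ'|) τ₋(x - ζ s, ζ')}
  f(p(x - ζ s, ζ'), ζ') dζ' ds`. -/
def termII (γ : ℝ) (β : ℝ → ℝ) (Ω : Set E3) (f : E3 → E3 → ℝ) (x ζ : E3) : ℝ :=
  ∫ s in flightTimes Ω x ζ, ∫ ζ' : E3, integrandII γ β Ω f x ζ s ζ'

/-- `d₀`: the distance of the pair `x, y` to `∂Ω`. -/
def boundaryDist (Ω : Set E3) (x y : E3) : ℝ :=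
  min (Metric.infDist x (frontier Ω)) (Metric.infDist y (frontier Ω))

end LinBoltzmann

end

namespace LinBoltzmann

/-! ### Elementary inequalities -/

/-! Write `II` as `∫ e^{-νs} G(x - sζ, ζ) ds` over the flight time, where `G(z, ζ) = ∫ k(ζ, η) I(z,
η) dη` and `I` is the damped boundary value. Hölder continuity passes from `f` to `I`, then to `G`,
then to `II`, and the dependence on the distance `d` to the boundary is tracked at each stage.

For `I`, convexity is decisive. A ball of radius `d` about `y`, carried for time `s` along a
trajectory with exit time `t₂`, still contains a ball of radius `(1 - s/t₂)d` inside `Ω`. The exit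
point of a shorter trajectory avoids that ball, hence `(1 - t₁/t₂)d ≤ |x - y| + t₁|ζ₁ - ζ₂|`
(`cone_condition`). This controls both exit times and exit points, because `t₂|ζ₂|` is at most the
diameter. The factors `1 + t₁` are absorbed by `e^{-νt₁}`, with `ν` bounded below, so small
velocities need no separate treatment (`abs_termI_sub_le`).

For `G`, the substitution `η = ζ + v` fixes the singularity at `v = 0`. The kernel `k(ζ, ζ + v)` is
dominated by an integrable `H(v)` and is Lipschitz in `ζ` with constant `H(v)`. For the gain part,
`ρ = r tan θ` turns the angular integral into a planar Gaussian integral of size `r⁻²`, which leads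
to `|v|^{γ-2} e^{-|v|²/4}`, integrable on `ℝ³` (`exists_isTranslationKernel_kernelGain`).

For `II`, the Hölder constant of `G` along the flight grows like `(1 - s/t)^{-σ}`. Against `e^{-cs}`
this is integrable uniformly in `t` (`integrableOn_decayMajorant`). The times at which only the
longer trajectory is still in flight contribute a difference of survival factors (`abs_tail_le`).
The outcome carries `(1 + d₀⁻¹)^σ`, which is weakened to the cube. -/

theorem min_one_le_rpow {t σ : ℝ} (ht : 0 ≤ t) (hσ0 : 0 ≤ σ) (hσ1 : σ ≤ 1) :
    min 1 t ≤ t ^ σ := by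
  rcases le_total t 1 with h | h
  · rw [min_eq_right h]
    rcases ht.eq_or_lt with rfl | h0
    · exact Real.rpow_nonneg le_rfl _
    · simpa using Real.rpow_le_rpow_of_exponent_ge h0 h hσ1
  · rw [min_eq_left h]
    exact Real.one_le_rpow h hσ0

theorem mul_rpow_le_of_one_le {c x σ : ℝ} (hc : 1 ≤ c) (hx : 0 ≤ x) (hσ1 : σ ≤ 1) :
    (c * x) ^ σ ≤ c * x ^ σ := by
  rw [Real.mul_rpow (by linarith) hx]
  gcongr
  simpa using Real.rpow_le_rpow_of_exponent_le hc hσ1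

/-- If `a ≤ B` and `a ≤ B t` with `t ≤ c x`, `1 ≤ c`, then `a ≤ B c x ^ σ`. -/
theorem le_mul_rpow_of_le_min {a B t c x σ : ℝ} (hB : 0 ≤ B) (hc : 1 ≤ c) (hx : 0 ≤ x)
    (hσ0 : 0 ≤ σ) (hσ1 : σ ≤ 1) (h1 : a ≤ B) (h2 : a ≤ B * t) (ht : t ≤ c * x) :
    a ≤ B * (c * x ^ σ) := by
  have h3 : a ≤ B * min 1 (c * x) := by
    rcases le_total 1 (c * x) with h | h
    · rw [min_eq_left h]; linarith
    · rw [min_eq_right h]; exact h2.trans (by gcongr)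
  have hcx : 0 ≤ c * x := by positivity
  exact h3.trans (mul_le_mul_of_nonneg_left
    ((min_one_le_rpow hcx hσ0 hσ1).trans (mul_rpow_le_of_one_le hc hx hσ1)) hB)

theorem mul_exp_neg_le_one (x : ℝ) : x * Real.exp (-x) ≤ 1 := by
  have h := Real.add_one_le_exp x
  rw [Real.exp_neg, ← div_eq_mul_inv, div_le_one (Real.exp_pos _)]
  linarith

theorem one_add_mul_exp_le {c t : ℝ} (hc : 0 < c) (ht : 0 ≤ t) :
    (1 + t) * Real.exp (-(c * t)) ≤ 1 + c⁻¹ := by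
  have h1 : Real.exp (-(c * t)) ≤ 1 := Real.exp_le_one_iff.2 (by nlinarith)
  have h2 := mul_exp_neg_le_one (c * t)
  have h3 : t * Real.exp (-(c * t)) ≤ c⁻¹ := by
    rw [← one_div, le_div_iff₀ hc]; linarith
  linarith

theorem abs_exp_neg_sub_exp_neg_le {a b m : ℝ} (ha : m ≤ a) (hb : m ≤ b) :
    |Real.exp (-a) - Real.exp (-b)| ≤ Real.exp (-m) * |a - b| := by
  wlog h : a ≤ b generalizing a b
  · rw [abs_sub_comm, abs_sub_comm a]; exact this hb ha (by linarith)
  have h1 : Real.exp (-b) = Real.exp (-a) * Real.exp (-(b - a)) := by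
    rw [← Real.exp_add]; ring_nf
  have h2 := Real.add_one_le_exp (-(b - a))
  have h3 : Real.exp (-b) ≤ Real.exp (-a) := Real.exp_le_exp.2 (by linarith)
  have h4 : Real.exp (-a) ≤ Real.exp (-m) := Real.exp_le_exp.2 (by linarith)
  rw [abs_of_nonneg (by linarith), abs_of_nonpos (by linarith)]
  have := Real.exp_pos (-a)
  calc Real.exp (-a) - Real.exp (-b) = Real.exp (-a) * (1 - Real.exp (-(b - a))) := by rw [h1]; ring
    _ ≤ Real.exp (-a) * (b - a) := mul_le_mul_of_nonneg_left (by linarith) this.le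
    _ ≤ Real.exp (-m) * (b - a) := mul_le_mul_of_nonneg_right h4 (by linarith)
    _ = _ := by ring

theorem abs_exp_neg_sub_exp_neg_le' {a b m : ℝ} (ha : m ≤ a) (hb : m ≤ b) :
    |Real.exp (-a) - Real.exp (-b)| ≤ Real.exp (-m) := by
  have h3 : Real.exp (-a) ≤ Real.exp (-m) := Real.exp_le_exp.2 (by linarith)
  have h4 : Real.exp (-b) ≤ Real.exp (-m) := Real.exp_le_exp.2 (by linarith)
  have := Real.exp_pos (-a)
  have := Real.exp_pos (-b)
  rw [abs_le]; constructor <;> linarith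

/-! ### Survival factor along a trajectory -/

open Classical in
/-- The survival factor `e^{-ν τ}`, with `e^{-∞} = 0`. -/
noncomputable def survival (ν : ℝ) (τ : ℝ≥0∞) : ℝ :=
  if τ = ∞ then 0 else Real.exp (-(ν * τ.toReal))

theorem survival_top (ν : ℝ) : survival ν ∞ = 0 := if_pos rfl

theorem survival_of_ne {ν : ℝ} {τ : ℝ≥0∞} (h : τ ≠ ∞) :
    survival ν τ = Real.exp (-(ν * τ.toReal)) := if_neg h

theorem survival_nonneg (ν : ℝ) (τ : ℝ≥0∞) : 0 ≤ survival ν τ := by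
  unfold survival; split_ifs <;> positivity

/-- If `ε/d ≥ 1/2` the bound is trivial. Otherwise `t₂ ≤ 2t₁`, and the mean value estimate produces
a factor `νt₁`, which half of the exponential absorbs. The constant therefore does not involve `ν`,
only its lower bound. -/
theorem exp_sub_exp_le_of_cone {ν ν₀ t₁ t₂ d ε : ℝ} (hν₀ : 0 < ν₀) (hν : ν₀ ≤ ν) (h1 : 0 ≤ t₁)
    (h12 : t₁ ≤ t₂) (h2 : 0 < t₂) (hd : 0 < d) (hε : (1 - t₁ / t₂) * d ≤ ε) :
    Real.exp (-(ν * t₁)) - Real.exp (-(ν * t₂)) ≤ Real.exp (-(ν₀ * t₁ / 2)) * (4 * (ε / d)) := by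
  have hν' : 0 < ν := by linarith
  have hexp : Real.exp (-(ν * t₁ / 2)) ≤ Real.exp (-(ν₀ * t₁ / 2)) :=
    Real.exp_le_exp.2 (by nlinarith)
  have hsplit : Real.exp (-(ν * t₁)) = Real.exp (-(ν * t₁ / 2)) * Real.exp (-(ν * t₁ / 2)) := by
    rw [← Real.exp_add]; ring_nf
  have hle1 : Real.exp (-(ν * t₁ / 2)) ≤ 1 := Real.exp_le_one_iff.2 (by
    have := mul_nonneg hν'.le h1; linarith)
  have hp := Real.exp_pos (-(ν * t₁ / 2))
  have hp0 := Real.exp_pos (-(ν₀ * t₁ / 2))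
  have hp2 := Real.exp_pos (-(ν * t₂))
  have hε' : 1 - t₁ / t₂ ≤ ε / d := by rwa [le_div_iff₀ hd]
  have hε0 : 0 ≤ ε / d := le_trans (by rw [sub_nonneg, div_le_one h2]; exact h12) hε'
  rcases le_or_gt (1 / 2) (ε / d) with h | h
  · have : Real.exp (-(ν * t₁)) ≤ Real.exp (-(ν₀ * t₁ / 2)) := by rw [hsplit]; nlinarith
    nlinarith
  · have ht2 : t₂ ≤ 2 * t₁ := by
      have : 1 / 2 < t₁ / t₂ := by linarith
      rw [lt_div_iff₀ h2] at this; linarith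
    have hdiff : t₂ - t₁ ≤ 2 * t₁ * (ε / d) := by
      have h3 : t₂ - t₁ = t₂ * (1 - t₁ / t₂) := by field_simp
      rw [h3]; gcongr
      rw [sub_nonneg, div_le_one h2]; exact h12
    have h4 := (le_abs_self _).trans (abs_exp_neg_sub_exp_neg_le (a := ν * t₁) (b := ν * t₂) le_rfl
      (by gcongr))
    have h5 : |ν * t₁ - ν * t₂| = ν * (t₂ - t₁) := by
      rw [← mul_sub, abs_mul, abs_of_pos hν', abs_sub_comm, abs_of_nonneg (by linarith)]
    rw [h5] at h4
    have h6 := mul_exp_neg_le_one (ν * t₁ / 2)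
    calc _ ≤ Real.exp (-(ν * t₁)) * (ν * (t₂ - t₁)) := h4
      _ ≤ Real.exp (-(ν * t₁)) * (ν * (2 * t₁ * (ε / d))) := by gcongr
      _ = Real.exp (-(ν * t₁ / 2)) * ((ν * t₁ / 2 * Real.exp (-(ν * t₁ / 2))) * (4 * (ε / d))) := by
        rw [hsplit]; ring
      _ ≤ Real.exp (-(ν₀ * t₁ / 2)) * (1 * (4 * (ε / d))) := by gcongr
      _ = _ := by ring

/-- The loss of survival between two exit times that are related by the cone condition. -/
theorem survival_sub_le {ν ν₀ d δ σ : ℝ} {τ₁ τ₂ : ℝ≥0∞} (hν₀ : 0 < ν₀) (hν : ν₀ ≤ ν)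
    (hτ : τ₁ ≤ τ₂) (hτ1 : τ₁ ≠ ∞) (hτ2 : τ₂ ≠ 0) (hd : 0 < d) (hδ : 0 ≤ δ) (hσ0 : 0 ≤ σ) (hσ1 : σ ≤ 1)
    (hε : (1 - τ₁.toReal / τ₂.toReal) * d ≤ (1 + τ₁.toReal) * δ) :
    survival ν τ₁ - survival ν τ₂ ≤ 4 * (1 + (ν₀ / 2)⁻¹) * (δ / d) ^ σ := by
  set t := τ₁.toReal with ht
  have ht0 : 0 ≤ t := ENNReal.toReal_nonneg
  have hmain : survival ν τ₁ - survival ν τ₂ ≤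
      (4 * Real.exp (-(ν₀ * t / 2))) * ((1 + t) * (δ / d)) := by
    rw [survival_of_ne hτ1]
    by_cases h2 : τ₂ = ∞
    · subst h2
      rw [survival_top, sub_zero]
      -- Since `∞.toReal = 0` and division by zero gives `0`, the cone hypothesis here reads `d ≤ (1
      -- + t)δ`, as it should for an infinite second flight.
      rw [ENNReal.toReal_top, div_zero, sub_zero, one_mul] at hε
      have h3 : 1 ≤ (1 + t) * (δ / d) := by rw [← mul_div_assoc, le_div_iff₀ hd]; linarith
      have h4 : Real.exp (-(ν * t)) ≤ Real.exp (-(ν₀ * t / 2)) := Real.exp_le_exp.2 (by nlinarith)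
      have := Real.exp_pos (-(ν₀ * t / 2))
      nlinarith
    · rw [survival_of_ne h2]
      have := exp_sub_exp_le_of_cone hν₀ hν ht0 (ENNReal.toReal_mono h2 hτ)
        (ENNReal.toReal_pos hτ2 h2) hd hε
      refine this.trans (le_of_eq ?_)
      ring
  have hone : survival ν τ₁ - survival ν τ₂ ≤ 4 * Real.exp (-(ν₀ * t / 2)) := by
    have h1 := survival_nonneg ν τ₂
    have h4 : Real.exp (-(ν * t)) ≤ Real.exp (-(ν₀ * t / 2)) := Real.exp_le_exp.2 (by nlinarith)
    rw [survival_of_ne hτ1] at *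
    have := Real.exp_pos (-(ν₀ * t / 2))
    linarith
  -- Interpolation between the trivial and the linear bound takes `1 + t` out of the power, and the
  -- remaining exponential absorbs it.
  have h := le_mul_rpow_of_le_min (x := δ / d) (by positivity) (by linarith : 1 ≤ 1 + t)
    (by positivity) hσ0 hσ1 hone hmain le_rfl
  refine h.trans ?_
  have h5 := one_add_mul_exp_le (half_pos hν₀) ht0
  have h6 : Real.exp (-(ν₀ * t / 2)) = Real.exp (-(ν₀ / 2 * t)) := by ring_nf
  rw [h6]
  calc _ = 4 * ((1 + t) * Real.exp (-(ν₀ / 2 * t))) * (δ / d) ^ σ := by ring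
    _ ≤ _ := by gcongr

end LinBoltzmann

namespace LinBoltzmann

/-! ### Geometry of backward trajectories -/

variable {Ω : Set E3} {x y ζ ζ₁ ζ₂ : E3}

/-- Off its frontier, the space splits into the disjoint open sets `t` and `(closure t)ᶜ`, and a
connected set cannot meet both. -/
theorem subset_of_disjoint_frontier {X : Type*} [TopologicalSpace X] {s t : Set X}
    (ht : IsOpen t) (hs : IsPreconnected s) (hst : (s ∩ t).Nonempty)
    (hd : Disjoint s (frontier t)) : s ⊆ t := by
  refine hs.subset_left_of_subset_union ht isClosed_closure.isOpen_compl (v := (closure t)ᶜ)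
    (disjoint_compl_right.mono_left subset_closure) ?_ hst
  intro z hz
  by_contra h
  simp only [mem_union, mem_compl_iff, not_or, not_not] at h
  refine disjoint_left.1 hd hz ?_
  rw [ht.frontier_eq]
  exact ⟨h.2, h.1⟩

theorem ball_infDist_frontier_subset (hΩo : IsOpen Ω) (hx : x ∈ Ω) :
    Metric.ball x (Metric.infDist x (frontier Ω)) ⊆ Ω := by
  rcases (Metric.infDist_nonneg (x := x) (s := frontier Ω)).eq_or_lt with h | h
  · rw [← h]; simp
  refine subset_of_disjoint_frontier hΩo (convex_ball _ _).isPreconnected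
    ⟨x, Metric.mem_ball_self h, hx⟩ ?_
  rw [disjoint_left]
  intro z hz hzf
  have := Metric.infDist_le_dist_of_mem (x := x) hzf
  rw [Metric.mem_ball, dist_comm] at hz
  linarith

theorem infDist_frontier_pos (hΩo : IsOpen Ω) (hΩb : Bornology.IsBounded Ω) (hx : x ∈ Ω) :
    0 < Metric.infDist x (frontier Ω) := by
  have hne : (frontier Ω).Nonempty := by
    rw [nonempty_frontier_iff]
    refine ⟨⟨x, hx⟩, ?_⟩
    rintro rfl
    exact NormedSpace.unbounded_univ ℝ E3 hΩb
  rw [← (isClosed_frontier.notMem_iff_infDist_pos hne)]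
  rw [hΩo.frontier_eq]
  exact fun h => h.2 hx

theorem sub_smul_mem_of_lt_tauMinus (hΩo : IsOpen Ω) (hx : x ∈ Ω) {s : ℝ} (hs0 : 0 ≤ s)
    (hs : ENNReal.ofReal s < tauMinus Ω x ζ) : x - s • ζ ∈ Ω := by
  have hseg : (fun t : ℝ => x - t • ζ) '' Icc 0 s ⊆ Ω := by
    refine subset_of_disjoint_frontier hΩo (isPreconnected_Icc.image _ (by fun_prop)) ?_ ?_
    · exact ⟨x, ⟨0, ⟨le_rfl, hs0⟩, by simp⟩, hx⟩
    · rw [disjoint_left]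
      rintro _ ⟨t, ht, rfl⟩ hf
      have : tauMinus Ω x ζ ≤ ENNReal.ofReal t :=
        iInf₂_le (Real.toNNReal t) (by rwa [Real.coe_toNNReal t ht.1])
      exact absurd (hs.trans_le this) (not_lt.2 (ENNReal.ofReal_le_ofReal ht.2))
  exact hseg ⟨s, ⟨hs0, le_rfl⟩, rfl⟩

/-- The infimum defining the exit time is attained, because the set of hitting times is closed and,
when the infimum is finite, nonempty. -/
theorem exitPoint_mem_frontier (h : tauMinus Ω x ζ ≠ ∞) : exitPoint Ω x ζ ∈ frontier Ω := by
  set S : Set ℝ≥0 := {s | x - (s : ℝ) • ζ ∈ frontier Ω} with hS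
  have hne : S.Nonempty := by
    by_contra hempty
    rw [not_nonempty_iff_eq_empty] at hempty
    apply h
    unfold tauMinus
    simp only [iInf_eq_top]
    intro s hs
    have : s ∈ S := hs
    simp [hempty] at this
  have hcl : IsClosed S := isClosed_frontier.preimage
    (f := fun s : ℝ≥0 => x - (s : ℝ) • ζ) (by fun_prop)
  have hmem := hcl.csInf_mem hne (OrderBot.bddBelow _)
  have heq : tauMinus Ω x ζ = ((sInf S : ℝ≥0) : ℝ≥0∞) := (ENNReal.coe_sInf hne).symm
  unfold exitPoint
  rw [heq]
  exact hmem

theorem notMem_of_mem_frontier (hΩo : IsOpen Ω) (hx : x ∈ frontier Ω) : x ∉ Ω := by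
  rw [hΩo.frontier_eq] at hx; exact hx.2

theorem tauMinus_ne_zero (hΩo : IsOpen Ω) (hx : x ∈ Ω) : tauMinus Ω x ζ ≠ 0 := by
  intro h
  have := exitPoint_mem_frontier (Ω := Ω) (x := x) (ζ := ζ) (by simp [h])
  refine notMem_of_mem_frontier hΩo this ?_
  simpa [exitPoint, h] using hx

theorem eq_zero_of_tauMinus_eq_top (hΩo : IsOpen Ω) (hΩb : Bornology.IsBounded Ω) (hx : x ∈ Ω)
    (h : tauMinus Ω x ζ = ∞) : ζ = 0 := by
  by_contra hζ
  obtain ⟨R, hR⟩ := hΩb.exists_norm_le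
  have hn : 0 < ‖ζ‖ := norm_pos_iff.2 hζ
  have hR0 : 0 ≤ R := (norm_nonneg _).trans (hR x hx)
  -- A time at which the displacement has length `2R + 1`, more than the diameter `2R` of a ball
  -- containing `Ω`.
  set s := (2 * R + 1) / ‖ζ‖
  have hs : 0 ≤ s := by positivity
  have h1 := hR _ (sub_smul_mem_of_lt_tauMinus (ζ := ζ) hΩo hx hs (by rw [h]; simp))
  have h2 := hR x hx
  have h3 : ‖s • ζ‖ = 2 * R + 1 := by
    rw [norm_smul, Real.norm_of_nonneg hs]; simp only [s]; field_simp
  have h4 := norm_sub_norm_le (s • ζ) x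
  rw [norm_sub_rev] at h4
  linarith

/-- The homothety of ratio `1 - l` centred at `q` maps the ball about `y` onto this ball. A proper
convex combination of a closure point and an interior point is interior. -/
theorem cone_subset (hΩo : IsOpen Ω) (hΩc : Convex ℝ Ω) {q : E3} (hq : q ∈ closure Ω)
    {d l : ℝ} (hl0 : 0 ≤ l) (hl1 : l ≤ 1) (hy : Metric.ball y d ⊆ Ω) :
    Metric.ball (l • q + (1 - l) • y) ((1 - l) * d) ⊆ Ω := by
  intro w hw
  rw [Metric.mem_ball, dist_eq_norm] at hw
  rcases hl1.eq_or_lt with rfl | hl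
  · simp only [sub_self, zero_mul] at hw
    exact absurd hw (not_lt.2 (norm_nonneg _))
  have hl' : 0 < 1 - l := by linarith
  set u := (1 - l)⁻¹ • (w - (l • q + (1 - l) • y)) with hu
  have hyu : y + u ∈ Ω := by
    apply hy
    rw [Metric.mem_ball, dist_eq_norm, add_sub_cancel_left, hu, norm_smul, norm_inv,
      Real.norm_of_nonneg hl'.le, inv_mul_lt_iff₀ hl']
    exact hw
  have hw' : w = l • q + (1 - l) • (y + u) := by
    rw [hu, smul_add, smul_smul, mul_inv_cancel₀ hl'.ne', one_smul]; abel
  rw [hw', ← hΩo.interior_eq]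
  exact hΩc.combo_closure_interior_mem_interior hq (by rwa [hΩo.interior_eq]) hl0 hl' (by ring)

/-- A ball around `x` shrinks at most linearly while it is carried along the backward
trajectory. (For `τ₋ = ∞` the velocity is zero and the ball does not move.) -/
theorem ball_sub_smul_subset (hΩo : IsOpen Ω) (hΩb : Bornology.IsBounded Ω) (hΩc : Convex ℝ Ω)
    (hx : x ∈ Ω) {d s : ℝ} (hball : Metric.ball x d ⊆ Ω) (hs0 : 0 ≤ s)
    (hs : ENNReal.ofReal s ≤ tauMinus Ω x ζ) :
    Metric.ball (x - s • ζ) ((1 - s / (tauMinus Ω x ζ).toReal) * d) ⊆ Ω := by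
  by_cases h : tauMinus Ω x ζ = ∞
  · rw [eq_zero_of_tauMinus_eq_top hΩo hΩb hx h] at *
    simpa [h] using hball
  · set t := (tauMinus Ω x ζ).toReal with ht
    have ht0 : 0 < t := ENNReal.toReal_pos (tauMinus_ne_zero hΩo hx) h
    have hst : s ≤ t := (ENNReal.ofReal_le_iff_le_toReal h).1 hs
    have := cone_subset hΩo hΩc (frontier_subset_closure (exitPoint_mem_frontier h))
      (div_nonneg hs0 ht0.le) ((div_le_one ht0).2 hst) hball
    convert this using 2
    rw [exitPoint, ← ht, smul_sub, smul_smul, div_mul_cancel₀ _ ht0.ne', sub_smul, one_smul]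
    abel

/-- Comparison of two exit times. -/
theorem cone_condition (hΩo : IsOpen Ω) (hΩb : Bornology.IsBounded Ω) (hΩc : Convex ℝ Ω)
    (hy : y ∈ Ω) {d : ℝ} (hball : Metric.ball y d ⊆ Ω)
    (hτ : tauMinus Ω x ζ₁ ≤ tauMinus Ω y ζ₂) (hτ1 : tauMinus Ω x ζ₁ ≠ ∞) :
    (1 - (tauMinus Ω x ζ₁).toReal / (tauMinus Ω y ζ₂).toReal) * d
      ≤ ‖x - y‖ + (tauMinus Ω x ζ₁).toReal * ‖ζ₁ - ζ₂‖ := by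
  set t := (tauMinus Ω x ζ₁).toReal with ht
  have ht0 : 0 ≤ t := ENNReal.toReal_nonneg
  have h1 := ball_sub_smul_subset hΩo hΩb hΩc hy hball ht0
    (by rw [ht, ENNReal.ofReal_toReal hτ1]; exact hτ)
  -- A frontier point is outside the open set `Ω`, hence outside the transported ball, so its
  -- distance to the centre bounds the radius from above.
  have h2 : exitPoint Ω x ζ₁ ∉ Metric.ball (y - t • ζ₂) ((1 - t / (tauMinus Ω y ζ₂).toReal) * d) :=
    fun h => notMem_of_mem_frontier hΩo (exitPoint_mem_frontier hτ1) (h1 h)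
  rw [Metric.mem_ball, not_lt, dist_eq_norm] at h2
  refine h2.trans ?_
  have h3 : exitPoint Ω x ζ₁ - (y - t • ζ₂) = (x - y) - t • (ζ₁ - ζ₂) := by
    rw [exitPoint, ← ht, smul_sub]; abel
  rw [h3]
  refine (norm_sub_le _ _).trans ?_
  rw [norm_smul, Real.norm_of_nonneg ht0]

theorem toReal_tauMinus_mul_norm_le {D : ℝ}
    (hD : ∀ a ∈ closure Ω, ∀ b ∈ closure Ω, ‖a - b‖ ≤ D) (hx : x ∈ Ω)
    (h : tauMinus Ω x ζ ≠ ∞) : (tauMinus Ω x ζ).toReal * ‖ζ‖ ≤ D := by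
  have := hD x (subset_closure hx) _ (frontier_subset_closure (exitPoint_mem_frontier h))
  rwa [exitPoint, sub_sub_cancel, norm_smul, Real.norm_of_nonneg ENNReal.toReal_nonneg] at this

/-- Exit points are incoming: the trajectory enters the convex set transversally. -/
theorem exitPoint_mem_incoming (hΩo : IsOpen Ω) (hΩc : Convex ℝ Ω) (hΩ1 : HasC1Boundary Ω)
    (hx : x ∈ Ω) (h : tauMinus Ω x ζ ≠ ∞) : (exitPoint Ω x ζ, ζ) ∈ incoming Ω := by
  set p := exitPoint Ω x ζ with hp
  set t := (tauMinus Ω x ζ).toReal with ht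
  have ht0 : 0 < t := ENNReal.toReal_pos (tauMinus_ne_zero hΩo hx) h
  have hpf : p ∈ frontier Ω := exitPoint_mem_frontier h
  have hxp : x = p + t • ζ := by rw [hp, exitPoint, ← ht]; abel
  obtain ⟨ρ, hρ⟩ := hΩ1 p hpf
  set g := gradient ρ p with hg
  have hgn : 0 < ‖g‖ := norm_pos_iff.2 hρ.gradient_ne
  refine ⟨hpf, ‖g‖⁻¹ • g, ⟨ρ, hρ, rfl⟩, ?_⟩
  have hdiff : HasGradientAt ρ g p := (hρ.contDiffAt.differentiableAt (by simp)).hasGradientAt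
  -- By convexity the open segment from `p` towards `p + w` lies in `Ω`, where `ρ < 0`, while `ρ p ≥
  -- 0`. The right derivative of `ρ` along it is therefore nonpositive.
  have hkey : ∀ w : E3, p + w ∈ Ω → inner ℝ g w ≤ 0 := by
    intro w hw
    have hmem : ∀ᶠ r : ℝ in 𝓝[>] 0, p + r • w ∈ Ω := by
      filter_upwards [Ioo_mem_nhdsGT (zero_lt_one' ℝ)] with r hr
      have := hΩc.combo_closure_interior_mem_interior (frontier_subset_closure hpf)
        (by rwa [hΩo.interior_eq] : p + w ∈ interior Ω) (a := 1 - r) (b := r)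
        (by linarith [hr.2]) hr.1 (by ring)
      rw [hΩo.interior_eq] at this
      convert this using 1
      rw [sub_smul, one_smul, smul_add]; abel
    have hcurve : HasDerivAt (fun r : ℝ => ρ (p + r • w)) (inner ℝ g w) 0 := by
      have h1 : HasDerivAt (fun r : ℝ => p + r • w) w 0 := by
        simpa using ((hasDerivAt_id (0 : ℝ)).smul_const w).const_add p
      have h2 := hdiff.hasFDerivAt
      have h3 : HasFDerivAt ρ ((InnerProductSpace.toDual ℝ E3) g) (p + (0 : ℝ) • w) := by
        simpa using h2
      exact (h3.comp_hasDerivAt (0 : ℝ) h1).congr_deriv (by simp)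
    have hp0 : 0 ≤ ρ p := by
      by_contra hneg
      exact notMem_of_mem_frontier hΩo hpf ((hρ.eventually_iff.self_of_nhds).2 (not_le.1 hneg))
    have hneg : ∀ᶠ r : ℝ in 𝓝[>] 0, ρ (p + r • w) < 0 := by
      have hc : Tendsto (fun r : ℝ => p + r • w) (𝓝[>] 0) (𝓝 p) := by
        have : Continuous (fun r : ℝ => p + r • w) := by fun_prop
        simpa using (this.tendsto 0).mono_left nhdsWithin_le_nhds
      filter_upwards [hc.eventually hρ.eventually_iff, hmem] with r h1 h2 using h1.1 h2
    have hslope := hasDerivAt_iff_tendsto_slope.1 hcurve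
    have hslope' := hslope.mono_left
      (nhdsWithin_mono (s := Ioi (0 : ℝ)) 0 (fun r (hr : (0 : ℝ) < r) => hr.ne'))
    refine le_of_tendsto hslope' ?_
    filter_upwards [hneg, self_mem_nhdsWithin] with r h1 (h2 : 0 < r)
    rw [slope_def_field]
    refine div_nonpos_of_nonpos_of_nonneg ?_ (by linarith)
    simp only [zero_smul, add_zero]
    linarith
  obtain ⟨d, hd, hball⟩ := Metric.isOpen_iff.1 hΩo x hx
  -- Strict negativity comes from the room around `x`: the direction `tζ` may be tilted by a small
  -- positive multiple of `g` and still point into `Ω`.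
  have hw := hkey (t • ζ + (d / 2 / ‖g‖) • g) (by
    rw [← add_assoc, ← hxp]
    apply hball
    rw [Metric.mem_ball, dist_eq_norm, add_sub_cancel_left, norm_smul,
      Real.norm_of_nonneg (by positivity), div_mul_cancel₀ _ hgn.ne']
    linarith)
  rw [inner_add_right, inner_smul_right, inner_smul_right, real_inner_self_eq_norm_sq] at hw
  rw [inner_smul_right, real_inner_comm]
  have h1 : 0 < d / 2 / ‖g‖ * ‖g‖ ^ 2 := by positivity
  have h2 : t * inner ℝ g ζ < 0 := by linarith
  exact mul_neg_of_pos_of_neg (inv_pos.2 hgn) (neg_of_mul_neg_right h2 ht0.le)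

end LinBoltzmann

namespace LinBoltzmann

/-! ### Hölder continuity of the boundary term -/

/-- The bounds on `f` on the incoming set. -/
structure IsHolderData (Ω : Set E3) (A M σ : ℝ) (f : E3 → E3 → ℝ) : Prop where
  bound : ∀ q ∈ incoming Ω, |f q.1 q.2| ≤ A
  holder : ∀ q ∈ incoming Ω, ∀ r ∈ incoming Ω,
    |f q.1 q.2 - f r.1 r.2| ≤ M * (‖q.1 - r.1‖ ^ 2 + ‖q.2 - r.2‖ ^ 2) ^ (σ / 2)

/-- The geometric setting: a bounded open convex set with `C¹` boundary and diameter at most `D`. -/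
structure IsConvexDomain (Ω : Set E3) (D : ℝ) : Prop where
  isOpen : IsOpen Ω
  isBounded : Bornology.IsBounded Ω
  convex : Convex ℝ Ω
  c1 : HasC1Boundary Ω
  diam : ∀ a ∈ closure Ω, ∀ b ∈ closure Ω, ‖a - b‖ ≤ D

/-- A function of the velocity which is bounded below and Lipschitz. -/
structure IsFrequency (ν : E3 → ℝ) (ν₀ L : ℝ) : Prop where
  pos : 0 < ν₀
  lower : ∀ ζ, ν₀ ≤ ν ζ
  lipschitz : ∀ ζ₁ ζ₂, |ν ζ₁ - ν ζ₂| ≤ L * ‖ζ₁ - ζ₂‖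

theorem sq_add_sq_rpow_le {a b σ : ℝ} (ha : 0 ≤ a) (hb : 0 ≤ b) (hσ : 0 ≤ σ) :
    (a ^ 2 + b ^ 2) ^ (σ / 2) ≤ (a + b) ^ σ := by
  calc (a ^ 2 + b ^ 2) ^ (σ / 2) ≤ ((a + b) ^ 2) ^ (σ / 2) :=
        Real.rpow_le_rpow (by positivity) (by nlinarith) (by positivity)
    _ = _ := by
      rw [← Real.rpow_natCast, ← Real.rpow_mul (by positivity)]
      congr 1; push_cast; ring

theorem add_rpow_le_sq_add_sq {a b σ : ℝ} (ha : 0 ≤ a) (hb : 0 ≤ b) (hσ : 0 ≤ σ) (hσ1 : σ ≤ 1) :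
    (a + b) ^ σ ≤ 2 * (a ^ 2 + b ^ 2) ^ (σ / 2) := by
  have h1 : a + b ≤ 2 * Real.sqrt (a ^ 2 + b ^ 2) := by
    have h2 : a ≤ Real.sqrt (a ^ 2 + b ^ 2) := Real.le_sqrt_of_sq_le (by nlinarith)
    have h3 : b ≤ Real.sqrt (a ^ 2 + b ^ 2) := Real.le_sqrt_of_sq_le (by nlinarith)
    linarith
  refine (Real.rpow_le_rpow (by positivity) h1 hσ).trans ?_
  refine (mul_rpow_le_of_one_le one_le_two (Real.sqrt_nonneg _) hσ1).trans (le_of_eq ?_)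
  rw [Real.sqrt_eq_rpow, ← Real.rpow_mul (by positivity)]
  congr 2; ring

variable {γ : ℝ} {β : ℝ → ℝ} {Ω : Set E3} {f : E3 → E3 → ℝ} {A M σ D ν₀ L d : ℝ}
  {x y ζ ζ₁ ζ₂ : E3}

theorem termI_of_top (h : tauMinus Ω x ζ = ∞) : termI γ β Ω f x ζ = 0 := if_pos h

theorem termI_of_ne_top (h : tauMinus Ω x ζ ≠ ∞) : termI γ β Ω f x ζ =
    f (exitPoint Ω x ζ) ζ * Real.exp (-(nu γ β ζ * (tauMinus Ω x ζ).toReal)) := if_neg h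

theorem abs_termI_le (hΩ : IsConvexDomain Ω D) (hν : IsFrequency (nu γ β) ν₀ L)
    (hf : IsHolderData Ω A M σ f) (hA : 0 ≤ A) (hx : x ∈ Ω) : |termI γ β Ω f x ζ| ≤ A := by
  by_cases h : tauMinus Ω x ζ = ∞
  · rw [termI_of_top h, abs_zero]; exact hA
  · rw [termI_of_ne_top h, abs_mul, Real.abs_exp]
    have h1 := hf.bound _ (exitPoint_mem_incoming hΩ.isOpen hΩ.convex hΩ.c1 hx h)
    have h2 : Real.exp (-(nu γ β ζ * (tauMinus Ω x ζ).toReal)) ≤ 1 := by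
      refine Real.exp_le_one_iff.2 ?_
      have := mul_nonneg (hν.pos.le.trans (hν.lower ζ)) (tauMinus Ω x ζ).toReal_nonneg
      linarith
    calc _ ≤ A * 1 := by gcongr
      _ = A := mul_one A

/-- The Hölder constant of the boundary term. -/
noncomputable def holderConstI (A M D ν₀ L : ℝ) : ℝ :=
  (2 * (1 + D) * M + (1 + L) * A + 4 * A) * (1 + (ν₀ / 2)⁻¹)

theorem holderConstI_nonneg (hA : 0 ≤ A) (hM : 0 ≤ M) (hD : 0 ≤ D) (hν₀ : 0 < ν₀) (hL : 0 ≤ L) :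
    0 ≤ holderConstI A M D ν₀ L := by
  unfold holderConstI; positivity

theorem one_add_mul_exp_le_half {t : ℝ} (hν₀ : 0 < ν₀) (ht : 0 ≤ t) :
    (1 + t) * Real.exp (-(ν₀ * t)) ≤ 1 + (ν₀ / 2)⁻¹ := by
  refine le_trans ?_ (one_add_mul_exp_le (half_pos hν₀) ht)
  gcongr
  linarith

/-- Here `p` stands for the distance of exit points and `b₁` for that of velocities. As `σ ≤ 1`, the
growth `1 + t` in `p` leaves the power as a single factor, which the survival exponential absorbs.
-/
theorem holder_boundary_part {f₁ f₂ p δ t ν b₁ : ℝ} (hσ0 : 0 ≤ σ) (hσ1 : σ ≤ 1) (hM : 0 ≤ M)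
    (hD : 0 ≤ D) (hν₀ : 0 < ν₀) (hν : ν₀ ≤ ν) (ht : 0 ≤ t) (hp : 0 ≤ p) (hb : 0 ≤ b₁)
    (hb1 : b₁ ≤ δ) (hδ : 0 ≤ δ) (hd : 0 < d) (hpd : p ≤ (1 + t) * δ * (1 + D / d))
    (hfd : |f₁ - f₂| ≤ M * (p ^ 2 + b₁ ^ 2) ^ (σ / 2)) :
    |f₁ - f₂| * Real.exp (-(ν * t))
      ≤ 2 * (1 + D) * M * (1 + (ν₀ / 2)⁻¹) * (δ * (1 + d⁻¹)) ^ σ := by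
  have hdd : 0 < d⁻¹ := inv_pos.2 hd
  have h1 : p + b₁ ≤ (2 * (1 + t) * (1 + D)) * (δ * (1 + d⁻¹)) := by
    have h2 : 1 + D / d ≤ (1 + D) * (1 + d⁻¹) := by rw [div_eq_mul_inv]; nlinarith
    have h3 : p ≤ (1 + t) * δ * ((1 + D) * (1 + d⁻¹)) := hpd.trans (by gcongr)
    have h4 : (1 : ℝ) ≤ (1 + t) * ((1 + D) * (1 + d⁻¹)) :=
      one_le_mul_of_one_le_of_one_le (by linarith)
        (one_le_mul_of_one_le_of_one_le (by linarith) (by linarith))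
    nlinarith
  have h2 : (p ^ 2 + b₁ ^ 2) ^ (σ / 2) ≤ (2 * (1 + t) * (1 + D)) * (δ * (1 + d⁻¹)) ^ σ :=
    (sq_add_sq_rpow_le hp hb hσ0).trans
      ((Real.rpow_le_rpow (by positivity) h1 hσ0).trans
        (mul_rpow_le_of_one_le (by nlinarith) (by positivity) hσ1))
  have h3 : Real.exp (-(ν * t)) ≤ Real.exp (-(ν₀ * t)) := Real.exp_le_exp.2 (by nlinarith)
  have h4 := one_add_mul_exp_le_half hν₀ ht
  calc |f₁ - f₂| * Real.exp (-(ν * t))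
      ≤ (M * ((2 * (1 + t) * (1 + D)) * (δ * (1 + d⁻¹)) ^ σ)) * Real.exp (-(ν₀ * t)) := by
        gcongr
        exact hfd.trans (by gcongr)
    _ = 2 * (1 + D) * M * ((1 + t) * Real.exp (-(ν₀ * t))) * (δ * (1 + d⁻¹)) ^ σ := by ring
    _ ≤ _ := by gcongr

theorem holder_frequency_part {ν : E3 → ℝ} {δ t : ℝ} (hν : IsFrequency ν ν₀ L)
    (hL : 0 ≤ L) (hσ0 : 0 ≤ σ) (hσ1 : σ ≤ 1) (ht : 0 ≤ t) (hδ : ‖ζ₁ - ζ₂‖ ≤ δ) :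
    |Real.exp (-(ν ζ₁ * t)) - Real.exp (-(ν ζ₂ * t))|
      ≤ Real.exp (-(ν₀ * t)) * ((1 + L) * (1 + t) * δ ^ σ) := by
  have hm1 : ν₀ * t ≤ ν ζ₁ * t := by gcongr; exact hν.lower _
  have hm2 : ν₀ * t ≤ ν ζ₂ * t := by gcongr; exact hν.lower _
  have hδ0 : 0 ≤ δ := (norm_nonneg _).trans hδ
  refine le_mul_rpow_of_le_min (t := |ν ζ₁ * t - ν ζ₂ * t|) (Real.exp_pos _).le
    (one_le_mul_of_one_le_of_one_le (by linarith) (by linarith)) hδ0 hσ0 hσ1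
    (abs_exp_neg_sub_exp_neg_le' hm1 hm2) (abs_exp_neg_sub_exp_neg_le hm1 hm2) ?_
  rw [← sub_mul, abs_mul, abs_of_nonneg ht]
  calc |ν ζ₁ - ν ζ₂| * t ≤ L * δ * t := by
        gcongr
        exact (hν.lipschitz _ _).trans (by gcongr)
    _ ≤ (1 + L) * (1 + t) * δ := by nlinarith [mul_nonneg hL ht, mul_nonneg hL hδ0]

theorem cone_condition_one_add (hΩ : IsConvexDomain Ω D) (hy : y ∈ Ω)
    (hball : Metric.ball y d ⊆ Ω) (hτ : tauMinus Ω x ζ₁ ≤ tauMinus Ω y ζ₂)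
    (hτ1 : tauMinus Ω x ζ₁ ≠ ∞) :
    (1 - (tauMinus Ω x ζ₁).toReal / (tauMinus Ω y ζ₂).toReal) * d
      ≤ (1 + (tauMinus Ω x ζ₁).toReal) * (‖x - y‖ + ‖ζ₁ - ζ₂‖) := by
  refine (cone_condition hΩ.isOpen hΩ.isBounded hΩ.convex hy hball hτ hτ1).trans ?_
  have := mul_nonneg (tauMinus Ω x ζ₁).toReal_nonneg (norm_nonneg (x - y))
  nlinarith [norm_nonneg (ζ₁ - ζ₂)]

/-- The exit points differ by the displacement at the common time `t₁` plus the surplus flight `(t₂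
- t₁)ζ₂ = (1 - t₁/t₂) t₂ζ₂`. The cone condition bounds the first factor of the surplus and the
diameter bounds `t₂|ζ₂|`. -/
theorem exitPoint_sub_le (hΩ : IsConvexDomain Ω D) (hy : y ∈ Ω) (hd : 0 < d)
    (hball : Metric.ball y d ⊆ Ω) (hτ : tauMinus Ω x ζ₁ ≤ tauMinus Ω y ζ₂)
    (hτ2 : tauMinus Ω y ζ₂ ≠ ∞) :
    ‖exitPoint Ω x ζ₁ - exitPoint Ω y ζ₂‖
      ≤ (1 + (tauMinus Ω x ζ₁).toReal) * (‖x - y‖ + ‖ζ₁ - ζ₂‖) * (1 + D / d) := by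
  have hτ1 : tauMinus Ω x ζ₁ ≠ ∞ := ne_top_of_le_ne_top hτ2 hτ
  have hcone := cone_condition_one_add hΩ hy hball hτ hτ1
  have hD := toReal_tauMinus_mul_norm_le hΩ.diam hy hτ2
  have ht2 : 0 < (tauMinus Ω y ζ₂).toReal :=
    ENNReal.toReal_pos (tauMinus_ne_zero hΩ.isOpen hy) hτ2
  have ht12 := ENNReal.toReal_mono hτ2 hτ
  have ht1 : 0 ≤ (tauMinus Ω x ζ₁).toReal := ENNReal.toReal_nonneg
  simp only [exitPoint]
  set t₁ := (tauMinus Ω x ζ₁).toReal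
  set t₂ := (tauMinus Ω y ζ₂).toReal
  set δ := ‖x - y‖ + ‖ζ₁ - ζ₂‖ with hδ
  have hδ0 : 0 ≤ δ := by positivity
  have h0 : (x - t₁ • ζ₁) - (y - t₂ • ζ₂) = (x - y) - t₁ • (ζ₁ - ζ₂) + (t₂ - t₁) • ζ₂ := by
    rw [smul_sub, sub_smul]; abel
  have h1 : ‖(x - y) - t₁ • (ζ₁ - ζ₂)‖ ≤ (1 + t₁) * δ := by
    refine (norm_sub_le _ _).trans ?_
    rw [norm_smul, Real.norm_of_nonneg ht1]
    have := mul_nonneg ht1 (norm_nonneg (x - y))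
    nlinarith [norm_nonneg (ζ₁ - ζ₂)]
  have h2 : ‖(t₂ - t₁) • ζ₂‖ ≤ (1 + t₁) * δ * (D / d) := by
    rw [norm_smul, Real.norm_of_nonneg (by linarith)]
    have h3 : t₂ - t₁ = t₂ * (1 - t₁ / t₂) := by field_simp
    have h4 : 1 - t₁ / t₂ ≤ (1 + t₁) * δ / d := by rwa [le_div_iff₀ hd]
    have h5 : 0 ≤ 1 - t₁ / t₂ := by rw [sub_nonneg, div_le_one ht2]; exact ht12
    calc (t₂ - t₁) * ‖ζ₂‖ = (1 - t₁ / t₂) * (t₂ * ‖ζ₂‖) := by rw [h3]; ring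
      _ ≤ ((1 + t₁) * δ / d) * D := by gcongr
      _ = _ := by ring
  rw [h0]
  refine (norm_add_le _ _).trans ?_
  linarith

/-- Used with `e₁ = e^{-ν₁t₁}`, `e₂ = e^{-ν₂t₁}`, `e₃ = e^{-ν₂t₂}`, so that the three terms isolate
the change of boundary value, of frequency and of exit time. -/
theorem abs_mul_sub_mul_le {f₁ f₂ e₁ e₂ e₃ : ℝ} (h1 : 0 ≤ e₁) (h3 : e₃ ≤ e₂) :
    |f₁ * e₁ - f₂ * e₃| ≤ |f₁ - f₂| * e₁ + |f₂| * |e₁ - e₂| + |f₂| * (e₂ - e₃) := by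
  have hdec : f₁ * e₁ - f₂ * e₃ = (f₁ - f₂) * e₁ + f₂ * (e₁ - e₂) + f₂ * (e₂ - e₃) := by ring
  rw [hdec]
  refine (abs_add_three _ _ _).trans ?_
  rw [abs_mul, abs_mul, abs_mul, abs_of_nonneg h1, abs_of_nonneg (sub_nonneg.2 h3)]

theorem survival_tauMinus_sub_le {ν : ℝ} (hΩ : IsConvexDomain Ω D) (hν₀ : 0 < ν₀) (hν : ν₀ ≤ ν)
    (hσ0 : 0 ≤ σ) (hσ1 : σ ≤ 1) (hd : 0 < d) (hy : y ∈ Ω) (hyd : Metric.ball y d ⊆ Ω)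
    (hτ : tauMinus Ω x ζ₁ ≤ tauMinus Ω y ζ₂) (hτ1 : tauMinus Ω x ζ₁ ≠ ∞) :
    survival ν (tauMinus Ω x ζ₁) - survival ν (tauMinus Ω y ζ₂)
      ≤ 4 * (1 + (ν₀ / 2)⁻¹) * ((‖x - y‖ + ‖ζ₁ - ζ₂‖) * (1 + d⁻¹)) ^ σ := by
  have hdd : 0 < d⁻¹ := inv_pos.2 hd
  refine (survival_sub_le hν₀ hν hτ hτ1 (tauMinus_ne_zero hΩ.isOpen hy) hd
    (by positivity) hσ0 hσ1 (cone_condition_one_add hΩ hy hyd hτ hτ1)).trans ?_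
  rw [div_eq_mul_inv _ d]
  gcongr
  linarith

theorem abs_termI_sub_le_of_top (hΩ : IsConvexDomain Ω D) (hν : IsFrequency (nu γ β) ν₀ L)
    (hf : IsHolderData Ω A M σ f) (hA : 0 ≤ A)
    (hσ0 : 0 ≤ σ) (hσ1 : σ ≤ 1) (hd : 0 < d) (hx : x ∈ Ω) (hy : y ∈ Ω)
    (hyd : Metric.ball y d ⊆ Ω) (hτ1 : tauMinus Ω x ζ₁ ≠ ∞) (hτ2 : tauMinus Ω y ζ₂ = ∞) :
    |termI γ β Ω f x ζ₁ - termI γ β Ω f y ζ₂|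
      ≤ A * (4 * (1 + (ν₀ / 2)⁻¹) * ((‖x - y‖ + ‖ζ₁ - ζ₂‖) * (1 + d⁻¹)) ^ σ) := by
  have h1 := survival_tauMinus_sub_le (x := x) (ζ₁ := ζ₁) hΩ hν.pos (hν.lower ζ₁) hσ0 hσ1 hd hy hyd
    (hτ2 ▸ le_top) hτ1
  rw [survival_of_ne hτ1, hτ2, survival_top, sub_zero] at h1
  rw [termI_of_top hτ2, sub_zero, termI_of_ne_top hτ1, abs_mul, Real.abs_exp]
  exact mul_le_mul (hf.bound _ (exitPoint_mem_incoming hΩ.isOpen hΩ.convex hΩ.c1 hx hτ1)) h1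
    (Real.exp_pos _).le hA

theorem holder_combine {t₁ S S' X₁ X₂ X₃ φ : ℝ} (hA : 0 ≤ A) (hL : 0 ≤ L) (hν₀ : 0 ≤ (ν₀ / 2)⁻¹)
    (hS' : 0 ≤ S') (hS2 : S' ≤ S)
    (hB : (1 + t₁) * Real.exp (-(ν₀ * t₁)) ≤ 1 + (ν₀ / 2)⁻¹)
    (e1 : X₁ ≤ 2 * (1 + D) * M * (1 + (ν₀ / 2)⁻¹) * S)
    (e2 : |X₂| ≤ Real.exp (-(ν₀ * t₁)) * ((1 + L) * (1 + t₁) * S'))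
    (e3 : X₃ ≤ 4 * (1 + (ν₀ / 2)⁻¹) * S) (hφ : |φ| ≤ A) (hX₃ : 0 ≤ X₃) :
    X₁ + |φ| * |X₂| + |φ| * X₃ ≤ holderConstI A M D ν₀ L * S := by
  have e4 : |X₂| ≤ (1 + L) * (1 + (ν₀ / 2)⁻¹) * S := by
    calc _ ≤ _ := e2
      _ = (1 + L) * ((1 + t₁) * Real.exp (-(ν₀ * t₁))) * S' := by ring
      _ ≤ _ := by gcongr
  calc _ ≤ 2 * (1 + D) * M * (1 + (ν₀ / 2)⁻¹) * S + A * ((1 + L) * (1 + (ν₀ / 2)⁻¹) * S)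
        + A * (4 * (1 + (ν₀ / 2)⁻¹) * S) :=
        add_le_add_three e1 (mul_le_mul hφ e4 (abs_nonneg _) hA) (mul_le_mul hφ e3 hX₃ hA)
    _ = _ := by unfold holderConstI; ring

theorem abs_termI_sub_le_of_ne_top (hΩ : IsConvexDomain Ω D) (hν : IsFrequency (nu γ β) ν₀ L)
    (hf : IsHolderData Ω A M σ f) (hA : 0 ≤ A) (hM : 0 ≤ M) (hD : 0 ≤ D) (hL : 0 ≤ L)
    (hσ0 : 0 ≤ σ) (hσ1 : σ ≤ 1) (hd : 0 < d) (hx : x ∈ Ω) (hy : y ∈ Ω)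
    (hyd : Metric.ball y d ⊆ Ω) (hτ : tauMinus Ω x ζ₁ ≤ tauMinus Ω y ζ₂)
    (hτ2 : tauMinus Ω y ζ₂ ≠ ∞) :
    |termI γ β Ω f x ζ₁ - termI γ β Ω f y ζ₂|
      ≤ holderConstI A M D ν₀ L * ((‖x - y‖ + ‖ζ₁ - ζ₂‖) * (1 + d⁻¹)) ^ σ := by
  have hν₀ := hν.pos
  have hdd : 0 < d⁻¹ := inv_pos.2 hd
  have hτ1 : tauMinus Ω x ζ₁ ≠ ∞ := ne_top_of_le_ne_top hτ2 hτ
  have hin1 := exitPoint_mem_incoming hΩ.isOpen hΩ.convex hΩ.c1 hx hτ1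
  have hin2 := exitPoint_mem_incoming hΩ.isOpen hΩ.convex hΩ.c1 hy hτ2
  have ht1 : 0 ≤ (tauMinus Ω x ζ₁).toReal := ENNReal.toReal_nonneg
  have hδ1 : ‖ζ₁ - ζ₂‖ ≤ ‖x - y‖ + ‖ζ₁ - ζ₂‖ := by linarith [norm_nonneg (x - y)]
  have hδ0 : 0 ≤ ‖x - y‖ + ‖ζ₁ - ζ₂‖ := by positivity
  have hfd : |f (exitPoint Ω x ζ₁) ζ₁ - f (exitPoint Ω y ζ₂) ζ₂| ≤
      M * (‖exitPoint Ω x ζ₁ - exitPoint Ω y ζ₂‖ ^ 2 + ‖ζ₁ - ζ₂‖ ^ 2) ^ (σ / 2) :=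
    hf.holder _ hin1 _ hin2
  have hp := exitPoint_sub_le hΩ hy hd hyd hτ hτ2
  have e1 := holder_boundary_part hσ0 hσ1 hM hD hν₀ (hν.lower ζ₁) ht1 (norm_nonneg _)
    (norm_nonneg _) hδ1 hδ0 hd hp hfd
  have e2 := holder_frequency_part hν hL hσ0 hσ1 ht1 hδ1
  have e3 := survival_tauMinus_sub_le hΩ hν₀ (hν.lower ζ₂) hσ0 hσ1 hd hy hyd hτ hτ1
  rw [survival_of_ne hτ1, survival_of_ne hτ2] at e3
  have hmono : Real.exp (-(nu γ β ζ₂ * (tauMinus Ω y ζ₂).toReal))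
      ≤ Real.exp (-(nu γ β ζ₂ * (tauMinus Ω x ζ₁).toReal)) := by
    have := ENNReal.toReal_mono hτ2 hτ
    have := hν₀.le.trans (hν.lower ζ₂)
    gcongr
  have hS2 : (‖x - y‖ + ‖ζ₁ - ζ₂‖) ^ σ ≤ ((‖x - y‖ + ‖ζ₁ - ζ₂‖) * (1 + d⁻¹)) ^ σ :=
    Real.rpow_le_rpow hδ0 (by nlinarith) hσ0
  have hS0 : 0 ≤ ((‖x - y‖ + ‖ζ₁ - ζ₂‖) * (1 + d⁻¹)) ^ σ := by positivity
  have hB := one_add_mul_exp_le_half hν₀ ht1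
  have hf2 := hf.bound _ hin2
  rw [termI_of_ne_top hτ1, termI_of_ne_top hτ2]
  exact (abs_mul_sub_mul_le (Real.exp_pos _).le hmono).trans (holder_combine hA hL
    (by positivity) (by positivity) hS2 hB e1 e2 e3 hf2 (sub_nonneg.2 hmono))

/-- By symmetry the flight from `y` may be taken as the longer one, and the cone is built over the
ball about `y`. An infinite longer flight means zero velocity and a vanishing term, which the
survival estimate covers. -/
theorem abs_termI_sub_le (hΩ : IsConvexDomain Ω D) (hν : IsFrequency (nu γ β) ν₀ L)
    (hf : IsHolderData Ω A M σ f) (hA : 0 ≤ A) (hM : 0 ≤ M) (hD : 0 ≤ D) (hL : 0 ≤ L)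
    (hσ0 : 0 ≤ σ) (hσ1 : σ ≤ 1) (hd : 0 < d) (hx : x ∈ Ω) (hy : y ∈ Ω)
    (hxd : Metric.ball x d ⊆ Ω) (hyd : Metric.ball y d ⊆ Ω) :
    |termI γ β Ω f x ζ₁ - termI γ β Ω f y ζ₂|
      ≤ holderConstI A M D ν₀ L * ((‖x - y‖ + ‖ζ₁ - ζ₂‖) * (1 + d⁻¹)) ^ σ := by
  wlog hτ : tauMinus Ω x ζ₁ ≤ tauMinus Ω y ζ₂ generalizing x y ζ₁ ζ₂
  · rw [abs_sub_comm, norm_sub_rev x, norm_sub_rev ζ₁]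
    exact this hy hx hyd hxd (le_of_not_ge hτ)
  have hν₀ := hν.pos
  have hCnn := holderConstI_nonneg hA hM hD hν₀ hL
  by_cases hτ2 : tauMinus Ω y ζ₂ = ∞
  · by_cases hτ1 : tauMinus Ω x ζ₁ = ∞
    · rw [termI_of_top hτ1, termI_of_top hτ2, sub_self, abs_zero]
      positivity
    refine (abs_termI_sub_le_of_top hΩ hν hf hA hσ0 hσ1 hd hx hy hyd hτ1 hτ2).trans ?_
    rw [← mul_assoc]
    gcongr
    unfold holderConstI
    have : 0 ≤ (2 * (1 + D) * M + (1 + L) * A) * (1 + (ν₀ / 2)⁻¹) := by positivity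
    linarith
  · exact abs_termI_sub_le_of_ne_top hΩ hν hf hA hM hD hL hσ0 hσ1 hd hx hy hyd hτ hτ2

/-- The boundary data carry no measurability assumption. Measurability of the integrands is obtained
from this continuity, which follows from the local Hölder estimate. -/
theorem continuousOn_termI (hΩ : IsConvexDomain Ω D) (hν : IsFrequency (nu γ β) ν₀ L)
    (hf : IsHolderData Ω A M σ f) (hA : 0 ≤ A) (hM : 0 ≤ M) (hD : 0 ≤ D) (hL : 0 ≤ L)
    (hσ0 : 0 < σ) (hσ1 : σ ≤ 1) :
    ContinuousOn (fun q : E3 × E3 => termI γ β Ω f q.1 q.2) (Ω ×ˢ univ) := by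
  rintro ⟨x, ζ⟩ ⟨hx, -⟩
  obtain ⟨d, hd, hball⟩ := Metric.isOpen_iff.1 hΩ.isOpen x hx
  refine ContinuousAt.continuousWithinAt ?_
  rw [ContinuousAt, tendsto_iff_dist_tendsto_zero]
  set C := holderConstI A M D ν₀ L
  have hlim : Tendsto (fun q : E3 × E3 =>
      C * ((‖q.1 - x‖ + ‖q.2 - ζ‖) * (1 + (d / 2)⁻¹)) ^ σ) (𝓝 (x, ζ)) (𝓝 0) := by
    have hc : Continuous (fun q : E3 × E3 =>
        C * ((‖q.1 - x‖ + ‖q.2 - ζ‖) * (1 + (d / 2)⁻¹)) ^ σ) := by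
      refine continuous_const.mul (Continuous.rpow_const (by fun_prop) fun _ => Or.inr hσ0.le)
    have := hc.tendsto (x, ζ)
    simpa [Real.zero_rpow hσ0.ne'] using this
  refine squeeze_zero' (Eventually.of_forall fun _ => dist_nonneg) ?_ hlim
  have hnhds : ∀ᶠ q : E3 × E3 in 𝓝 (x, ζ), q.1 ∈ Metric.ball x (d / 2) :=
    continuous_fst.continuousAt.eventually (Metric.ball_mem_nhds x (half_pos hd))
  filter_upwards [hnhds] with q hq
  have hsub : Metric.ball q.1 (d / 2) ⊆ Ω := by
    refine subset_trans (fun w hw => ?_) hball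
    have h1 := dist_triangle w q.1 x
    simp only [Metric.mem_ball] at *
    linarith
  exact abs_termI_sub_le hΩ hν hf hA hM hD hL hσ0.le hσ1 (half_pos hd)
    (hsub (Metric.mem_ball_self (half_pos hd))) hx hsub
    ((Metric.ball_subset_ball (by linarith)).trans hball)

end LinBoltzmann

namespace LinBoltzmann

/-! ### The collision frequency -/

variable {γ : ℝ} {β : ℝ → ℝ} {ζ ζ₁ ζ₂ : E3}

/-- In polar coordinates the density `y²` raises the exponent to `s + 2 > -1`. -/
theorem integrable_rpow_mul_gaussian {b s : ℝ} (hb : 0 < b) (hs : -3 < s) :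
    Integrable (fun v : E3 => ‖v‖ ^ s * Real.exp (-b * ‖v‖ ^ 2)) := by
  rw [integrable_fun_norm_addHaar volume (f := fun y : ℝ => y ^ s * Real.exp (-b * y ^ 2))]
  refine (integrableOn_rpow_mul_exp_neg_mul_sq hb (s := s + 2) (by linarith)).congr_fun ?_
    measurableSet_Ioi
  intro y (hy : 0 < y)
  simp only [finrank_euclideanSpace, Fintype.card_fin, smul_eq_mul]
  rw [Real.rpow_add hy]
  norm_num
  ring

theorem integrable_gaussian : Integrable (fun v : E3 => Real.exp (-‖v‖ ^ 2)) := by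
  simpa using integrable_rpow_mul_gaussian (b := 1) (s := 0) one_pos (by norm_num)

theorem integrable_nu_integrand (hγ0 : 0 ≤ γ) (hγ1 : γ ≤ 1) (ζ : E3) :
    Integrable (fun η : E3 => Real.exp (-‖η‖ ^ 2) * ‖η - ζ‖ ^ γ) := by
  have h1 := integrable_rpow_mul_gaussian (b := 1) (s := γ) one_pos (by linarith)
  refine (h1.add (integrable_gaussian.const_mul (‖ζ‖ ^ γ))).mono'
    (Measurable.aestronglyMeasurable (by fun_prop)) (Eventually.of_forall fun η => ?_)
  rw [Real.norm_of_nonneg (by positivity)]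
  have h2 : ‖η - ζ‖ ^ γ ≤ ‖η‖ ^ γ + ‖ζ‖ ^ γ :=
    (Real.rpow_le_rpow (norm_nonneg _) (norm_sub_le _ _) hγ0).trans
      (Real.rpow_add_le_add_rpow (norm_nonneg _) (norm_nonneg _) hγ0 hγ1)
  calc _ ≤ Real.exp (-‖η‖ ^ 2) * (‖η‖ ^ γ + ‖ζ‖ ^ γ) := by gcongr
    _ = _ := by simp only [Pi.add_apply, neg_mul, one_mul]; ring

theorem betaZero_pos (hβ : IsCutoffAngular β) : 0 < betaZero β := hβ.nontrivial

/-- Writing `a^γ = a · a^{γ-1}` with a decreasing second factor avoids the failure of Lipschitz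
continuity at `0`, at the price of a weight that is still integrable on `ℝ³`. -/
theorem abs_rpow_sub_rpow_le {a b : ℝ} (ha : 0 < a) (hb : 0 < b) (hγ0 : 0 ≤ γ) (hγ1 : γ ≤ 1) :
    |a ^ γ - b ^ γ| ≤ |a - b| * (a ^ (γ - 1) + b ^ (γ - 1)) := by
  wlog h : a ≤ b generalizing a b
  · rw [abs_sub_comm, abs_sub_comm a, add_comm]; exact this hb ha (by linarith)
  have hmono : a ^ γ ≤ b ^ γ := Real.rpow_le_rpow ha.le h hγ0
  rw [abs_sub_comm, abs_of_nonneg (by linarith), abs_sub_comm, abs_of_nonneg (by linarith)]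
  have h1 : b ^ γ = b * b ^ (γ - 1) := by
    rw [Real.rpow_sub_one hb.ne']; field_simp
  have h2 : a ^ γ = a * a ^ (γ - 1) := by
    rw [Real.rpow_sub_one ha.ne']; field_simp
  have h3 : b ^ (γ - 1) ≤ a ^ (γ - 1) := Real.rpow_le_rpow_of_nonpos ha h (by linarith)
  have h4 : 0 ≤ b ^ (γ - 1) := by positivity
  rw [h1, h2]
  nlinarith

/-- A Gaussian weight integrates an integrable negative power uniformly in its centre. -/
theorem rpow_mul_gaussian_le {s a b : ℝ} (hs : s ≤ 0) (hb : 0 ≤ b) :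
    Real.exp (-a ^ 2) * b ^ s ≤
      Real.exp (-a ^ 2) + Real.exp 1 * (b ^ s * Real.exp (-1 * b ^ 2)) := by
  have hbs : 0 ≤ b ^ s := by positivity
  have h0 : 0 ≤ Real.exp 1 * (b ^ s * Real.exp (-1 * b ^ 2)) := by positivity
  have he : 0 < Real.exp (-a ^ 2) := Real.exp_pos _
  have he1 : Real.exp (-a ^ 2) ≤ 1 := Real.exp_le_one_iff.2 (by nlinarith [sq_nonneg a])
  rcases le_or_gt 1 b with h | h
  · have : b ^ s ≤ 1 := Real.rpow_le_one_of_one_le_of_nonpos h hs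
    nlinarith
  · have h1 : 1 ≤ Real.exp 1 * Real.exp (-1 * b ^ 2) := by
      rw [← Real.exp_add]; exact Real.one_le_exp (by nlinarith)
    have : b ^ s ≤ Real.exp 1 * (b ^ s * Real.exp (-1 * b ^ 2)) := by nlinarith
    nlinarith

theorem exists_abs_nu_sub_le (hβ : IsCutoffAngular β) (hγ0 : 0 ≤ γ) (hγ1 : γ ≤ 1) :
    ∃ L : ℝ, 0 ≤ L ∧ ∀ ζ₁ ζ₂ : E3, |nu γ β ζ₁ - nu γ β ζ₂| ≤ L * ‖ζ₁ - ζ₂‖ := by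
  set g : E3 → ℝ := fun v => ‖v‖ ^ (γ - 1) * Real.exp (-1 * ‖v‖ ^ 2) with hg
  have hgi : Integrable g := integrable_rpow_mul_gaussian one_pos (by linarith)
  have hg0 : ∀ v, 0 ≤ g v := fun v => by positivity
  set G := (∫ v : E3, Real.exp (-‖v‖ ^ 2)) + Real.exp 1 * ∫ v, g v with hG
  have hβ0 := betaZero_pos hβ
  have hG0 : 0 ≤ G := add_nonneg (integral_nonneg fun _ => (Real.exp_pos _).le)
    (mul_nonneg (Real.exp_pos _).le (integral_nonneg hg0))
  refine ⟨betaZero β * (2 * G), by positivity, fun ζ₁ ζ₂ => ?_⟩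
  rw [nu, nu, ← mul_sub, abs_mul, abs_of_pos hβ0,
    ← integral_sub (integrable_nu_integrand hγ0 hγ1 ζ₁) (integrable_nu_integrand hγ0 hγ1 ζ₂),
    mul_assoc]
  refine mul_le_mul_of_nonneg_left ?_ hβ0.le
  set H : E3 → E3 → ℝ := fun ζ η => Real.exp (-‖η‖ ^ 2) + Real.exp 1 * g (η - ζ) with hH
  have hHi : ∀ ζ, Integrable (H ζ) := fun ζ =>
    integrable_gaussian.add ((hgi.comp_sub_right ζ).const_mul _)
  have hHint : ∀ ζ, ∫ η, H ζ η = G := fun ζ => by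
    rw [hH, hG, integral_add integrable_gaussian ((hgi.comp_sub_right ζ).const_mul _),
      integral_const_mul, integral_sub_right_eq_self g]
  have hmain : |∫ η : E3, (Real.exp (-‖η‖ ^ 2) * ‖η - ζ₁‖ ^ γ
      - Real.exp (-‖η‖ ^ 2) * ‖η - ζ₂‖ ^ γ)| ≤ ∫ η, ‖ζ₁ - ζ₂‖ * (H ζ₁ η + H ζ₂ η) := by
    rw [← Real.norm_eq_abs]
    refine norm_integral_le_of_norm_le (((hHi ζ₁).add (hHi ζ₂)).const_mul _) ?_
    -- Almost every `η` avoids both centres, where the negative power bound is unavailable.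
    have hne : ∀ ζ : E3, ∀ᵐ η : E3, η ≠ ζ := fun ζ => by
      simp [ae_iff]
    filter_upwards [hne ζ₁, hne ζ₂] with η h1 h2
    rw [Real.norm_eq_abs, ← mul_sub, abs_mul, Real.abs_exp]
    have h3 := abs_rpow_sub_rpow_le (norm_pos_iff.2 (sub_ne_zero.2 h1))
      (norm_pos_iff.2 (sub_ne_zero.2 h2)) hγ0 hγ1
    have h4 : |‖η - ζ₁‖ - ‖η - ζ₂‖| ≤ ‖ζ₁ - ζ₂‖ := by
      refine (abs_norm_sub_norm_le _ _).trans (le_of_eq ?_)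
      rw [sub_sub_sub_cancel_left, norm_sub_rev]
    have hs : γ - 1 ≤ 0 := by linarith
    have h5 := rpow_mul_gaussian_le (a := ‖η‖) hs (norm_nonneg (η - ζ₁))
    have h6 := rpow_mul_gaussian_le (a := ‖η‖) hs (norm_nonneg (η - ζ₂))
    calc Real.exp (-‖η‖ ^ 2) * |‖η - ζ₁‖ ^ γ - ‖η - ζ₂‖ ^ γ|
        ≤ Real.exp (-‖η‖ ^ 2) * (‖ζ₁ - ζ₂‖ * (‖η - ζ₁‖ ^ (γ - 1) + ‖η - ζ₂‖ ^ (γ - 1))) := by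
          gcongr
          exact h3.trans (by gcongr)
      _ = ‖ζ₁ - ζ₂‖ * (Real.exp (-‖η‖ ^ 2) * ‖η - ζ₁‖ ^ (γ - 1)
            + Real.exp (-‖η‖ ^ 2) * ‖η - ζ₂‖ ^ (γ - 1)) := by ring
      _ ≤ _ := by gcongr
  refine hmain.trans (le_of_eq ?_)
  rw [integral_const_mul, integral_add (hHi ζ₁) (hHi ζ₂), hHint, hHint]
  ring

/-- Symmetrize under `η ↦ -η`: because `2|η| ≤ |η - ζ| + |-η - ζ|`, one of the two distances is at
least `|η|`. Hence half the frequency at zero velocity is a lower bound everywhere. -/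
theorem exists_le_nu (hβ : IsCutoffAngular β) (hγ0 : 0 ≤ γ) (hγ1 : γ ≤ 1) :
    ∃ ν₀ : ℝ, 0 < ν₀ ∧ ∀ ζ : E3, ν₀ ≤ nu γ β ζ := by
  have hβ0 := betaZero_pos hβ
  set P := ∫ η : E3, Real.exp (-‖η‖ ^ 2) * ‖η‖ ^ γ with hP
  have hPi : Integrable (fun η : E3 => Real.exp (-‖η‖ ^ 2) * ‖η‖ ^ γ) := by
    simpa using integrable_nu_integrand hγ0 hγ1 0
  have hP0 : 0 < P := by
    rw [hP, integral_pos_iff_support_of_nonneg (fun η => by positivity) hPi]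
    have hsub : {(0 : E3)}ᶜ ⊆ Function.support (fun η : E3 => Real.exp (-‖η‖ ^ 2) * ‖η‖ ^ γ) := by
      intro η hη
      have : 0 < ‖η‖ := norm_pos_iff.2 hη
      exact (by positivity : (0 : ℝ) < Real.exp (-‖η‖ ^ 2) * ‖η‖ ^ γ).ne'
    refine lt_of_lt_of_le ?_ (measure_mono hsub)
    exact isOpen_compl_singleton.measure_pos volume (by
      obtain ⟨v, hv⟩ := exists_ne (0 : E3)
      exact ⟨v, hv⟩)
  refine ⟨betaZero β * (P / 2), by positivity, fun ζ => ?_⟩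
  rw [nu]
  refine mul_le_mul_of_nonneg_left ?_ hβ0.le
  have hi := integrable_nu_integrand hγ0 hγ1 ζ
  have hrefl : ∫ η : E3, Real.exp (-‖η‖ ^ 2) * ‖-η - ζ‖ ^ γ
      = ∫ η : E3, Real.exp (-‖η‖ ^ 2) * ‖η - ζ‖ ^ γ := by
    simpa using integral_neg_eq_self (fun η : E3 => Real.exp (-‖η‖ ^ 2) * ‖η - ζ‖ ^ γ) volume
  have hi' : Integrable (fun η : E3 => Real.exp (-‖η‖ ^ 2) * ‖-η - ζ‖ ^ γ) := by
    simpa using hi.comp_neg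
  have hle : P ≤ ∫ η : E3, (Real.exp (-‖η‖ ^ 2) * ‖η - ζ‖ ^ γ
      + Real.exp (-‖η‖ ^ 2) * ‖-η - ζ‖ ^ γ) := by
    refine integral_mono hPi (hi.add hi') fun η => ?_
    have h1 : ‖η‖ ≤ max ‖η - ζ‖ ‖-η - ζ‖ := by
      have h2 : 2 * ‖η‖ ≤ ‖η - ζ‖ + ‖-η - ζ‖ := by
        calc 2 * ‖η‖ = ‖(η - ζ) - (-η - ζ)‖ := by
              rw [show (η - ζ) - (-η - ζ) = (2 : ℝ) • η by rw [two_smul]; abel, norm_smul]; simp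
          _ ≤ _ := norm_sub_le _ _
      have := le_max_left ‖η - ζ‖ ‖-η - ζ‖
      have := le_max_right ‖η - ζ‖ ‖-η - ζ‖
      linarith
    have h2 : ‖η‖ ^ γ ≤ ‖η - ζ‖ ^ γ + ‖-η - ζ‖ ^ γ := by
      have hr1 : 0 ≤ ‖η - ζ‖ ^ γ := by positivity
      have hr2 : 0 ≤ ‖-η - ζ‖ ^ γ := by positivity
      rcases le_max_iff.1 h1 with h | h
      · have := Real.rpow_le_rpow (norm_nonneg _) h hγ0; linarith
      · have := Real.rpow_le_rpow (norm_nonneg _) h hγ0; linarith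
    calc Real.exp (-‖η‖ ^ 2) * ‖η‖ ^ γ
        ≤ Real.exp (-‖η‖ ^ 2) * (‖η - ζ‖ ^ γ + ‖-η - ζ‖ ^ γ) := by gcongr
      _ = _ := by ring
  rw [integral_add hi hi', hrefl] at hle
  linarith

theorem exists_isFrequency_nu (hβ : IsCutoffAngular β) (hγ0 : 0 ≤ γ) (hγ1 : γ ≤ 1) :
    ∃ ν₀ L : ℝ, 0 ≤ L ∧ IsFrequency (nu γ β) ν₀ L := by
  obtain ⟨L, hL, h1⟩ := exists_abs_nu_sub_le hβ hγ0 hγ1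
  obtain ⟨ν₀, hν₀, h2⟩ := exists_le_nu hβ hγ0 hγ1
  exact ⟨ν₀, L, hL, ⟨hν₀, h2, h1⟩⟩

end LinBoltzmann

namespace LinBoltzmann

/-! ### The angular integral of the gain kernel -/

variable {γ : ℝ} {β : ℝ → ℝ} {ζ ζ₁ ζ₂ v : E3} {κ a a₁ a₂ r C : ℝ}

/-- The Gaussian `e^{-κ |a e₁ + ρ (cos ε, sin ε)|²}` in polar coordinates. -/
noncomputable def polarGaussian (κ a ρ ε : ℝ) : ℝ :=
  Real.exp (-(κ * ((a + ρ * Real.cos ε) ^ 2 + (ρ * Real.sin ε) ^ 2)))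

theorem polarGaussian_pos (κ a ρ ε : ℝ) : 0 < polarGaussian κ a ρ ε := Real.exp_pos _

/-- For a gap of at least `1` the estimate is trivial. Otherwise the factor `q + p` is absorbed by
half of the Gaussian, and the other half is kept because the bound has to be integrated over the
plane. -/
theorem exp_neg_sq_sub_le_of_le {p q : ℝ} (hp : 0 ≤ p) (h : p ≤ q) :
    Real.exp (-p ^ 2) - Real.exp (-q ^ 2) ≤ 3 * (q - p) * Real.exp (-(1 / 2 * p ^ 2)) := by
  have hE : Real.exp (-p ^ 2) = Real.exp (-(1 / 2 * p ^ 2)) * Real.exp (-(1 / 2 * p ^ 2)) := by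
    rw [← Real.exp_add]; congr 1; ring
  have hE1 : Real.exp (-(1 / 2 * p ^ 2)) ≤ 1 := Real.exp_le_one_iff.2 (by nlinarith)
  have hE0 := Real.exp_pos (-(1 / 2 * p ^ 2))
  have hq := Real.exp_pos (-q ^ 2)
  rcases le_or_gt 1 (q - p) with h1 | h1
  · nlinarith
  · have h2 : Real.exp (-p ^ 2) - Real.exp (-q ^ 2) ≤ Real.exp (-p ^ 2) * (q ^ 2 - p ^ 2) := by
      have h3 := (le_abs_self _).trans (abs_exp_neg_sub_exp_neg_le (a := p ^ 2) (b := q ^ 2) le_rfl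
        (by gcongr))
      rwa [abs_sub_comm, abs_of_nonneg (by nlinarith)] at h3
    -- From `e^u ≥ 1 + u` with `u = p²/2`, it suffices that `2p + 1 ≤ 3 + 3p²/2`, a quadratic
    -- without real roots.
    have h4 : (2 * p + 1) * Real.exp (-(1 / 2 * p ^ 2)) ≤ 3 := by
      have h5 := Real.add_one_le_exp (1 / 2 * p ^ 2)
      rw [Real.exp_neg, ← div_eq_mul_inv, div_le_iff₀ (Real.exp_pos _)]
      nlinarith [sq_nonneg (3 * p - 2)]
    calc _ ≤ Real.exp (-p ^ 2) * (q ^ 2 - p ^ 2) := h2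
      _ = (q + p) * Real.exp (-(1 / 2 * p ^ 2)) * (q - p) * Real.exp (-(1 / 2 * p ^ 2)) := by
        rw [hE]; ring
      _ ≤ (2 * p + 1) * Real.exp (-(1 / 2 * p ^ 2)) * (q - p) * Real.exp (-(1 / 2 * p ^ 2)) := by
        have h6 : q + p ≤ 2 * p + 1 := by linarith
        have h7 : 0 ≤ q - p := by linarith
        gcongr
      _ ≤ 3 * (q - p) * Real.exp (-(1 / 2 * p ^ 2)) := by
        have h7 : 0 ≤ q - p := by linarith
        gcongr

theorem exp_neg_sq_sub_le {p q : ℝ} :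
    |Real.exp (-p ^ 2) - Real.exp (-q ^ 2)|
      ≤ 3 * |p - q| * (Real.exp (-(1 / 2 * p ^ 2)) + Real.exp (-(1 / 2 * q ^ 2))) := by
  wlog h : |p| ≤ |q| generalizing p q
  · rw [abs_sub_comm, abs_sub_comm p, add_comm (Real.exp (-(1 / 2 * p ^ 2)))]
    exact this (le_of_not_ge h)
  have h1 := exp_neg_sq_sub_le_of_le (abs_nonneg p) h
  rw [sq_abs, sq_abs] at h1
  have h2 : |q| - |p| ≤ |p - q| := by
    rw [abs_sub_comm]; exact abs_sub_abs_le_abs_sub q p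
  have h3 : Real.exp (-q ^ 2) ≤ Real.exp (-p ^ 2) :=
    Real.exp_le_exp.2 (neg_le_neg (sq_le_sq.2 h))
  have h4 := Real.exp_pos (-(1 / 2 * q ^ 2))
  rw [abs_of_nonneg (by linarith)]
  calc _ ≤ _ := h1
    _ ≤ _ := by gcongr; linarith

/-- The value of the Gaussian integral over the plane. -/
noncomputable def planeGaussian (κ : ℝ) : ℝ≥0∞ :=
  ∫⁻ p : ℝ × ℝ, ENNReal.ofReal (Real.exp (-(κ * (p.1 ^ 2 + p.2 ^ 2))))

theorem planeGaussian_ne_top (hκ : 0 < κ) : planeGaussian κ ≠ ∞ := by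
  have h := (integrable_exp_neg_mul_sq hκ).mul_prod (integrable_exp_neg_mul_sq hκ)
  have h2 := h.lintegral_lt_top.ne
  refine ne_of_eq_of_ne (lintegral_congr fun p => ?_) h2
  rw [← Real.exp_add]
  congr 2; ring

/-- In Cartesian coordinates this is a translated planar Gaussian, so the bound does not depend on
`a`. -/
theorem lintegral_polarGaussian_le (κ a : ℝ) :
    ∫⁻ ρ in Ioi (0 : ℝ), ∫⁻ ε in Ioc (0 : ℝ) (2 * Real.pi),
      ENNReal.ofReal (ρ * polarGaussian κ a ρ ε) ≤ planeGaussian κ := by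
  set F : ℝ × ℝ → ℝ≥0∞ := fun p =>
    ENNReal.ofReal (Real.exp (-(κ * ((p.1 - a) ^ 2 + p.2 ^ 2)))) with hF
  have hFm : Measurable F := by fun_prop
  have hshift : ∫⁻ p, F p = planeGaussian κ := by
    have := lintegral_sub_right_eq_self (μ := (volume : Measure (ℝ × ℝ)))
      (fun p : ℝ × ℝ => ENNReal.ofReal (Real.exp (-(κ * (p.1 ^ 2 + p.2 ^ 2))))) (a, 0)
    rw [planeGaussian, ← this]
    simp [hF]
  have hang : ∀ ρ : ℝ, 0 < ρ → ∫⁻ ε in Ioc (0 : ℝ) (2 * Real.pi),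
      ENNReal.ofReal (ρ * polarGaussian κ a ρ ε)
      = ∫⁻ ε in Ioo (-Real.pi) Real.pi, ENNReal.ofReal ρ * F (ρ * Real.cos ε, ρ * Real.sin ε) := by
    intro ρ hρ
    -- `polarCoord` uses angles in `(-π, π)`. Shifting by `π` reverses the signs of `cos` and `sin`,
    -- which is why `F` is centred at `(a, 0)` rather than `(-a, 0)`.
    have hpre := (measurePreserving_sub_right (volume : Measure ℝ) Real.pi).setLIntegral_comp_preimage
      (s := Ioc (-Real.pi) Real.pi) measurableSet_Ioc
      (f := fun ε => ENNReal.ofReal ρ * F (ρ * Real.cos ε, ρ * Real.sin ε))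
      (by fun_prop)
    rw [Set.preimage_sub_const_Ioc] at hpre
    rw [setLIntegral_congr (Ioo_ae_eq_Ioc (μ := volume)), ← hpre]
    rw [neg_add_cancel, ← two_mul]
    refine lintegral_congr fun ε => ?_
    rw [ENNReal.ofReal_mul hρ.le, hF]
    simp only [Real.cos_sub_pi, Real.sin_sub_pi, polarGaussian]
    congr 4
    ring
  rw [setLIntegral_congr_fun measurableSet_Ioi (fun ρ hρ => hang ρ hρ)]
  rw [← hshift, ← lintegral_comp_polarCoord_symm F, polarCoord_target, Measure.volume_eq_prod,
    ← Measure.prod_restrict, lintegral_prod _ (by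
      have : Measurable fun p : ℝ × ℝ => ENNReal.ofReal p.1 • F (polarCoord.symm p) := by
        simp only [polarCoord_symm_apply, smul_eq_mul]
        fun_prop
      exact this.aemeasurable)]
  simp only [polarCoord_symm_apply, smul_eq_mul]
  exact le_rfl

/-- The product measure of the angular variables. -/
noncomputable def angleMeasure : Measure (ℝ × ℝ) :=
  (volume.restrict (Ioo 0 (Real.pi / 2))).prod (volume.restrict (Ioc 0 (2 * Real.pi)))

theorem measurable_tan : Measurable Real.tan := by
  have : Real.tan = fun x => Real.sin x / Real.cos x := funext Real.tan_eq_sin_div_cos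
  rw [this]; fun_prop

/-- The dominating angular weight. -/
noncomputable def angleWeight (κ a r : ℝ) (q : ℝ × ℝ) : ℝ :=
  Real.tan q.1 * (Real.cos q.1 ^ 2)⁻¹ * polarGaussian κ a (r * Real.tan q.1) q.2

theorem measurable_angleWeight : Measurable (angleWeight κ a r) := by
  have := measurable_tan
  unfold angleWeight polarGaussian
  fun_prop

/-- With `ρ = r tan θ` one has `tan θ (cos θ)⁻² dθ = r⁻² ρ dρ`. This is the origin of the `|v|⁻²`
singularity of the gain kernel. -/
theorem lintegral_angleWeight_le (hr : 0 < r) :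
    ∫⁻ q, ENNReal.ofReal (angleWeight κ a r q) ∂angleMeasure
      ≤ ENNReal.ofReal ((r ^ 2)⁻¹) * planeGaussian κ := by
  rw [angleMeasure, lintegral_prod _ measurable_angleWeight.ennreal_ofReal.aemeasurable]
  set g : ℝ → ℝ≥0∞ := fun ρ => ENNReal.ofReal ((r ^ 2)⁻¹) *
    ∫⁻ ε in Ioc (0 : ℝ) (2 * Real.pi), ENNReal.ofReal (ρ * polarGaussian κ a ρ ε) with hg
  have hcos : ∀ θ ∈ Ioo (0 : ℝ) (Real.pi / 2), 0 < Real.cos θ := fun θ hθ =>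
    Real.cos_pos_of_mem_Ioo ⟨by linarith [hθ.1, Real.pi_pos], hθ.2⟩
  have htan : ∀ θ ∈ Ioo (0 : ℝ) (Real.pi / 2), 0 < Real.tan θ := fun θ hθ =>
    Real.tan_pos_of_pos_of_lt_pi_div_two hθ.1 hθ.2
  have hderiv : ∀ θ ∈ Ioo (0 : ℝ) (Real.pi / 2), HasDerivWithinAt (fun θ => r * Real.tan θ)
      (r * (1 / Real.cos θ ^ 2)) (Ioo (0 : ℝ) (Real.pi / 2)) θ := fun θ hθ =>
    ((Real.hasDerivAt_tan (hcos θ hθ).ne').const_mul r).hasDerivWithinAt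
  have hinj : InjOn (fun θ => r * Real.tan θ) (Ioo (0 : ℝ) (Real.pi / 2)) := by
    intro x hx y hy hxy
    have hsub : Ioo (0 : ℝ) (Real.pi / 2) ⊆ Ioo (-(Real.pi / 2)) (Real.pi / 2) :=
      Ioo_subset_Ioo_left (by linarith [Real.pi_pos])
    exact Real.injOn_tan (hsub hx) (hsub hy) (mul_left_cancel₀ hr.ne' hxy)
  have hcv := lintegral_image_eq_lintegral_abs_deriv_mul measurableSet_Ioo hderiv hinj g
  have himg : (fun θ => r * Real.tan θ) '' Ioo (0 : ℝ) (Real.pi / 2) ⊆ Ioi 0 := by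
    rintro _ ⟨θ, hθ, rfl⟩
    exact mul_pos hr (htan θ hθ)
  calc _ = ∫⁻ θ in Ioo (0 : ℝ) (Real.pi / 2),
          ENNReal.ofReal |r * (1 / Real.cos θ ^ 2)| * g (r * Real.tan θ) := by
        refine setLIntegral_congr_fun measurableSet_Ioo fun θ hθ => ?_
        have hc := hcos θ hθ
        simp only [hg]
        rw [← mul_assoc, ← ENNReal.ofReal_mul (abs_nonneg _),
          ← lintegral_const_mul' _ _ ENNReal.ofReal_ne_top]
        refine lintegral_congr fun ε => ?_
        rw [← ENNReal.ofReal_mul (by positivity), abs_of_pos (by positivity), angleWeight]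
        congr 1
        field_simp
    _ = ∫⁻ ρ in (fun θ => r * Real.tan θ) '' Ioo (0 : ℝ) (Real.pi / 2), g ρ := hcv.symm
    _ ≤ ∫⁻ ρ in Ioi 0, g ρ := lintegral_mono_set himg
    _ ≤ _ := by
      rw [hg, lintegral_const_mul' _ _ ENNReal.ofReal_ne_top]
      gcongr
      exact lintegral_polarGaussian_le κ a

theorem ae_angleMeasure : ∀ᵐ q ∂angleMeasure, q.1 ∈ Ioo (0 : ℝ) (Real.pi / 2) := by
  rw [angleMeasure, Measure.prod_restrict]
  filter_upwards [ae_restrict_mem (measurableSet_Ioo.prod measurableSet_Ioc)] with q hq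
  exact hq.1

theorem angleWeight_nonneg {q : ℝ × ℝ} (hq : q.1 ∈ Ioo (0 : ℝ) (Real.pi / 2)) :
    0 ≤ angleWeight κ a r q := by
  have := Real.tan_pos_of_pos_of_lt_pi_div_two hq.1 hq.2
  have := polarGaussian_pos κ a (r * Real.tan q.1) q.2
  unfold angleWeight
  positivity

theorem integrable_angleWeight (hκ : 0 < κ) (hr : 0 < r) :
    Integrable (angleWeight κ a r) angleMeasure := by
  refine ⟨measurable_angleWeight.aestronglyMeasurable, ?_⟩
  rw [hasFiniteIntegral_iff_ofReal (ae_angleMeasure.mono fun q hq => angleWeight_nonneg hq)]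
  exact (lintegral_angleWeight_le hr).trans_lt
    (ENNReal.mul_lt_top ENNReal.ofReal_lt_top (planeGaussian_ne_top hκ).lt_top)

theorem integral_angleWeight_le (hκ : 0 < κ) (hr : 0 < r) :
    ∫ q, angleWeight κ a r q ∂angleMeasure ≤ (planeGaussian κ).toReal * (r ^ 2)⁻¹ := by
  rw [integral_eq_lintegral_of_nonneg_ae (ae_angleMeasure.mono fun q hq => angleWeight_nonneg hq)
    measurable_angleWeight.aestronglyMeasurable]
  refine (ENNReal.toReal_mono (ENNReal.mul_lt_top ENNReal.ofReal_lt_top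
    (planeGaussian_ne_top hκ).lt_top).ne (lintegral_angleWeight_le hr)).trans (le_of_eq ?_)
  rw [ENNReal.toReal_mul, ENNReal.toReal_ofReal (by positivity), mul_comm]

/-- The integrand of the angular integral in the gain kernel. -/
noncomputable def angleIntegrand (γ : ℝ) (β : ℝ → ℝ) (r a : ℝ) (q : ℝ × ℝ) : ℝ :=
  (β q.1 + β (Real.pi / 2 - q.1)) * Real.cos q.1 ^ (-(3 + γ))
    * Real.exp (-(a ^ 2 + 2 * a * (r * Real.tan q.1) * Real.cos q.2 + (r * Real.tan q.1) ^ 2))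

theorem angleIntegrand_eq (q : ℝ × ℝ) : angleIntegrand γ β r a q =
    (β q.1 + β (Real.pi / 2 - q.1)) * Real.cos q.1 ^ (-(3 + γ))
      * polarGaussian 1 a (r * Real.tan q.1) q.2 := by
  have h := Real.sin_sq_add_cos_sq q.2
  rw [angleIntegrand, polarGaussian]
  congr 3
  linear_combination (-(r * Real.tan q.1) ^ 2) * h

theorem measurable_angleIntegrand (hβ : Measurable β) : Measurable (angleIntegrand γ β r a) := by
  have := measurable_tan
  unfold angleIntegrand
  fun_prop

/-- The angular integral in the gain kernel. -/
noncomputable def angleIntegral (γ : ℝ) (β : ℝ → ℝ) (r a : ℝ) : ℝ :=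
  ∫ θ in (0 : ℝ)..(Real.pi / 2), ∫ ε in (0 : ℝ)..(2 * Real.pi), angleIntegrand γ β r a (θ, ε)

/-- The bound `C cos θ sin θ` is invariant under `θ ↦ π/2 - θ`, and `γ ≤ 1` limits the negative
power to `cos⁻⁴`. The product `cos θ sin θ cos⁻⁴ θ` is exactly the Jacobian weight of `ρ = r tan θ`.
-/
theorem angular_weight_bounds (hγ1 : γ ≤ 1) (hβ0 : ∀ θ ∈ Icc (0 : ℝ) (Real.pi / 2), 0 ≤ β θ)
    (hβC : ∀ θ ∈ Icc (0 : ℝ) (Real.pi / 2), β θ ≤ C * (Real.cos θ * Real.sin θ))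
    {θ : ℝ} (hθ : θ ∈ Ioo (0 : ℝ) (Real.pi / 2)) :
    0 ≤ (β θ + β (Real.pi / 2 - θ)) * Real.cos θ ^ (-(3 + γ)) ∧
    (β θ + β (Real.pi / 2 - θ)) * Real.cos θ ^ (-(3 + γ))
      ≤ 2 * C * (Real.tan θ * (Real.cos θ ^ 2)⁻¹) := by
  have hθ' : θ ∈ Icc (0 : ℝ) (Real.pi / 2) := Ioo_subset_Icc_self hθ
  have hθ'' : Real.pi / 2 - θ ∈ Icc (0 : ℝ) (Real.pi / 2) :=
    ⟨by linarith [hθ.2], by linarith [hθ.1]⟩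
  have hc : 0 < Real.cos θ := Real.cos_pos_of_mem_Ioo ⟨by linarith [hθ.1, Real.pi_pos], hθ.2⟩
  have hb0 : 0 ≤ β θ + β (Real.pi / 2 - θ) := add_nonneg (hβ0 _ hθ') (hβ0 _ hθ'')
  have hb : β θ + β (Real.pi / 2 - θ) ≤ 2 * C * (Real.cos θ * Real.sin θ) := by
    have h1 := hβC _ hθ'
    have h2 := hβC _ hθ''
    rw [Real.cos_pi_div_two_sub, Real.sin_pi_div_two_sub] at h2
    linarith
  have hp : Real.cos θ ^ (-(3 + γ)) ≤ Real.cos θ ^ (-4 : ℝ) :=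
    Real.rpow_le_rpow_of_exponent_ge hc (Real.cos_le_one θ) (by linarith)
  have hp4 : Real.cos θ ^ (-4 : ℝ) = (Real.cos θ ^ 4)⁻¹ := by
    rw [Real.rpow_neg hc.le]; norm_cast
  refine ⟨by positivity, ?_⟩
  calc _ ≤ (2 * C * (Real.cos θ * Real.sin θ)) * Real.cos θ ^ (-4 : ℝ) :=
        mul_le_mul hb hp (by positivity) (hb0.trans hb)
    _ = _ := by rw [hp4, Real.tan_eq_sin_div_cos]; field_simp

theorem abs_angleIntegrand_le (hγ1 : γ ≤ 1) (hβ0 : ∀ θ ∈ Icc (0 : ℝ) (Real.pi / 2), 0 ≤ β θ)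
    (hβC : ∀ θ ∈ Icc (0 : ℝ) (Real.pi / 2), β θ ≤ C * (Real.cos θ * Real.sin θ))
    {q : ℝ × ℝ} (hq : q.1 ∈ Ioo (0 : ℝ) (Real.pi / 2)) :
    |angleIntegrand γ β r a q| ≤ 2 * C * angleWeight 1 a r q := by
  obtain ⟨h1, h2⟩ := angular_weight_bounds hγ1 hβ0 hβC hq
  have h3 := polarGaussian_pos 1 a (r * Real.tan q.1) q.2
  rw [angleIntegrand_eq, abs_mul, abs_of_nonneg h1, abs_of_pos h3, angleWeight, ← mul_assoc]
  gcongr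

/-- The parameter `a` enters only the first Cartesian coordinate, so the one-dimensional estimate
applies there. The other factor is just weakened from rate `1` to rate `1/2`. -/
theorem abs_polarGaussian_sub_le (ρ ε : ℝ) :
    |polarGaussian 1 a₁ ρ ε - polarGaussian 1 a₂ ρ ε|
      ≤ 3 * |a₁ - a₂| * (polarGaussian (1 / 2) a₁ ρ ε + polarGaussian (1 / 2) a₂ ρ ε) := by
  have hsplit : ∀ κ a : ℝ, polarGaussian κ a ρ ε =
      Real.exp (-(κ * (a + ρ * Real.cos ε) ^ 2)) * Real.exp (-(κ * (ρ * Real.sin ε) ^ 2)) := by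
    intro κ a
    rw [polarGaussian, ← Real.exp_add]; congr 1; ring
  have h := exp_neg_sq_sub_le (p := a₁ + ρ * Real.cos ε) (q := a₂ + ρ * Real.cos ε)
  rw [add_sub_add_right_eq_sub] at h
  have hs : Real.exp (-(1 * (ρ * Real.sin ε) ^ 2)) ≤ Real.exp (-(1 / 2 * (ρ * Real.sin ε) ^ 2)) :=
    Real.exp_le_exp.2 (by nlinarith [sq_nonneg (ρ * Real.sin ε)])
  rw [hsplit, hsplit, hsplit, hsplit, ← sub_mul, abs_mul, Real.abs_exp, ← add_mul, ← mul_assoc]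
  simp only [one_mul] at *
  gcongr

theorem abs_angleIntegrand_sub_le (hγ1 : γ ≤ 1)
    (hβ0 : ∀ θ ∈ Icc (0 : ℝ) (Real.pi / 2), 0 ≤ β θ)
    (hβC : ∀ θ ∈ Icc (0 : ℝ) (Real.pi / 2), β θ ≤ C * (Real.cos θ * Real.sin θ))
    {q : ℝ × ℝ} (hq : q.1 ∈ Ioo (0 : ℝ) (Real.pi / 2)) :
    |angleIntegrand γ β r a₁ q - angleIntegrand γ β r a₂ q|
      ≤ 6 * C * |a₁ - a₂| * (angleWeight (1 / 2) a₁ r q + angleWeight (1 / 2) a₂ r q) := by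
  obtain ⟨h1, h2⟩ := angular_weight_bounds hγ1 hβ0 hβC hq
  rw [angleIntegrand_eq, angleIntegrand_eq, ← mul_sub, abs_mul, abs_of_nonneg h1]
  calc _ ≤ (2 * C * (Real.tan q.1 * (Real.cos q.1 ^ 2)⁻¹)) * (3 * |a₁ - a₂| *
          (polarGaussian (1 / 2) a₁ (r * Real.tan q.1) q.2
            + polarGaussian (1 / 2) a₂ (r * Real.tan q.1) q.2)) :=
        mul_le_mul h2 (abs_polarGaussian_sub_le _ _) (abs_nonneg _) (h1.trans h2)
    _ = _ := by unfold angleWeight; ring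

theorem integrable_angleIntegrand (hγ1 : γ ≤ 1) (hβm : Measurable β)
    (hβ0 : ∀ θ ∈ Icc (0 : ℝ) (Real.pi / 2), 0 ≤ β θ)
    (hβC : ∀ θ ∈ Icc (0 : ℝ) (Real.pi / 2), β θ ≤ C * (Real.cos θ * Real.sin θ)) (hr : 0 < r) :
    Integrable (angleIntegrand γ β r a) angleMeasure :=
  ((integrable_angleWeight one_pos hr).const_mul (2 * C)).mono'
    (measurable_angleIntegrand hβm).aestronglyMeasurable
    (ae_angleMeasure.mono fun _ hq => abs_angleIntegrand_le hγ1 hβ0 hβC hq)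

theorem angleIntegral_eq (hγ1 : γ ≤ 1) (hβm : Measurable β)
    (hβ0 : ∀ θ ∈ Icc (0 : ℝ) (Real.pi / 2), 0 ≤ β θ)
    (hβC : ∀ θ ∈ Icc (0 : ℝ) (Real.pi / 2), β θ ≤ C * (Real.cos θ * Real.sin θ)) (hr : 0 < r) :
    angleIntegral γ β r a = ∫ q, angleIntegrand γ β r a q ∂angleMeasure := by
  have h := integral_prod _ (integrable_angleIntegrand (a := a) hγ1 hβm hβ0 hβC hr)
  rw [← angleMeasure] at h
  rw [h, angleIntegral, intervalIntegral.integral_of_le (by positivity),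
    ← integral_Ioc_eq_integral_Ioo]
  refine integral_congr_ae (Eventually.of_forall fun θ => ?_)
  simp only
  rw [intervalIntegral.integral_of_le (by positivity)]

theorem abs_angleIntegral_le (hγ1 : γ ≤ 1) (hβm : Measurable β)
    (hβ0 : ∀ θ ∈ Icc (0 : ℝ) (Real.pi / 2), 0 ≤ β θ)
    (hβC : ∀ θ ∈ Icc (0 : ℝ) (Real.pi / 2), β θ ≤ C * (Real.cos θ * Real.sin θ))
    (hC : 0 ≤ C) (hr : 0 < r) :
    |angleIntegral γ β r a| ≤ 2 * C * (planeGaussian 1).toReal * (r ^ 2)⁻¹ := by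
  rw [angleIntegral_eq hγ1 hβm hβ0 hβC hr, ← Real.norm_eq_abs]
  refine (norm_integral_le_of_norm_le ((integrable_angleWeight one_pos hr).const_mul (2 * C))
    (ae_angleMeasure.mono fun q hq => abs_angleIntegrand_le hγ1 hβ0 hβC hq)).trans ?_
  rw [integral_const_mul, mul_assoc _ _ (r ^ 2)⁻¹]
  gcongr
  exact integral_angleWeight_le one_pos hr

theorem abs_angleIntegral_sub_le (hγ1 : γ ≤ 1) (hβm : Measurable β)
    (hβ0 : ∀ θ ∈ Icc (0 : ℝ) (Real.pi / 2), 0 ≤ β θ)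
    (hβC : ∀ θ ∈ Icc (0 : ℝ) (Real.pi / 2), β θ ≤ C * (Real.cos θ * Real.sin θ))
    (hC : 0 ≤ C) (hr : 0 < r) :
    |angleIntegral γ β r a₁ - angleIntegral γ β r a₂|
      ≤ 12 * C * (planeGaussian (1 / 2)).toReal * |a₁ - a₂| * (r ^ 2)⁻¹ := by
  have hi : ∀ a, Integrable (angleWeight (1 / 2) a r) angleMeasure := fun a =>
    integrable_angleWeight (by norm_num) hr
  rw [angleIntegral_eq hγ1 hβm hβ0 hβC hr, angleIntegral_eq hγ1 hβm hβ0 hβC hr,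
    ← integral_sub (integrable_angleIntegrand hγ1 hβm hβ0 hβC hr)
      (integrable_angleIntegrand hγ1 hβm hβ0 hβC hr), ← Real.norm_eq_abs]
  refine (norm_integral_le_of_norm_le (((hi a₁).add (hi a₂)).const_mul (6 * C * |a₁ - a₂|))
    (ae_angleMeasure.mono fun q hq => abs_angleIntegrand_sub_le hγ1 hβ0 hβC hq)).trans ?_
  simp only [Pi.add_apply]
  rw [integral_const_mul, integral_add (hi a₁) (hi a₂)]
  have h1 := integral_angleWeight_le (a := a₁) (by norm_num : (0 : ℝ) < 1 / 2) hr
  have h2 := integral_angleWeight_le (a := a₂) (by norm_num : (0 : ℝ) < 1 / 2) hr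
  calc _ ≤ 6 * C * |a₁ - a₂| * ((planeGaussian (1 / 2)).toReal * (r ^ 2)⁻¹
        + (planeGaussian (1 / 2)).toReal * (r ^ 2)⁻¹) := by gcongr
    _ = _ := by ring

end LinBoltzmann

namespace LinBoltzmann

/-! ### The collision kernel in translated variables -/

variable {γ : ℝ} {β : ℝ → ℝ} {ζ ζ₁ ζ₂ v : E3} {C : ℝ}

/-- The kernel `(ζ, v) ↦ k(ζ, ζ + v)` is bounded by an integrable function of `v` alone, and it is
Lipschitz in `ζ` with an integrable Lipschitz constant. -/
structure IsTranslationKernel (k : E3 → E3 → ℝ) (H : E3 → ℝ) : Prop where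
  measurable : ∀ ζ, Measurable (k ζ)
  integrable : Integrable H
  nonneg : ∀ v, 0 ≤ H v
  bound : ∀ ζ v, v ≠ 0 → |k ζ (ζ + v)| ≤ H v
  lipschitz : ∀ ζ₁ ζ₂ v, v ≠ 0 → |k ζ₁ (ζ₁ + v) - k ζ₂ (ζ₂ + v)| ≤ ‖ζ₁ - ζ₂‖ * H v

theorem IsTranslationKernel.sub {k₁ k₂ : E3 → E3 → ℝ} {H₁ H₂ : E3 → ℝ}
    (h₁ : IsTranslationKernel k₁ H₁) (h₂ : IsTranslationKernel k₂ H₂) :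
    IsTranslationKernel (fun ζ η => k₁ ζ η - k₂ ζ η) (fun v => H₁ v + H₂ v) where
  measurable ζ := (h₁.measurable ζ).sub (h₂.measurable ζ)
  integrable := h₁.integrable.add h₂.integrable
  nonneg v := add_nonneg (h₁.nonneg v) (h₂.nonneg v)
  bound ζ v hv := (abs_sub _ _).trans (add_le_add (h₁.bound ζ v hv) (h₂.bound ζ v hv))
  lipschitz ζ₁ ζ₂ v hv := by
    rw [sub_sub_sub_comm, mul_add]
    exact (abs_sub _ _).trans
      (add_le_add (h₁.lipschitz ζ₁ ζ₂ v hv) (h₂.lipschitz ζ₁ ζ₂ v hv))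

theorem abs_exp_neg_sq_sub_le (p q : ℝ) :
    |Real.exp (-p ^ 2) - Real.exp (-q ^ 2)| ≤ 6 * |p - q| := by
  have h1 : Real.exp (-(1 / 2 * p ^ 2)) ≤ 1 := Real.exp_le_one_iff.2 (by nlinarith [sq_nonneg p])
  have h2 : Real.exp (-(1 / 2 * q ^ 2)) ≤ 1 := Real.exp_le_one_iff.2 (by nlinarith [sq_nonneg q])
  calc _ ≤ 3 * |p - q| * (Real.exp (-(1 / 2 * p ^ 2)) + Real.exp (-(1 / 2 * q ^ 2))) :=
        exp_neg_sq_sub_le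
    _ ≤ 3 * |p - q| * (1 + 1) := by gcongr
    _ = _ := by ring

theorem exp_neg_sq_le_one (p : ℝ) : Real.exp (-p ^ 2) ≤ 1 :=
  Real.exp_le_one_iff.2 (by nlinarith [sq_nonneg p])

/-- Completing the square, `(|ζ|² + |ζ + v|²)/2 = |ζ + v/2|² + |v|²/4`. All dependence on `ζ` then
sits in a bounded Lipschitz factor. -/
theorem kernelLoss_add (ζ v : E3) : kernelLoss γ β ζ (ζ + v) =
    betaZero β * (‖v‖ ^ γ * Real.exp (-(1 / 4) * ‖v‖ ^ 2))
      * Real.exp (-‖ζ + (1 / 2 : ℝ) • v‖ ^ 2) := by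
  have h1 : ‖ζ - (ζ + v)‖ = ‖v‖ := by rw [sub_add_cancel_left, norm_neg]
  have h2 : Real.exp (-(‖ζ‖ ^ 2 + ‖ζ + v‖ ^ 2) / 2)
      = Real.exp (-(1 / 4) * ‖v‖ ^ 2) * Real.exp (-‖ζ + (1 / 2 : ℝ) • v‖ ^ 2) := by
    rw [← Real.exp_add, norm_add_sq_real, norm_add_sq_real, inner_smul_right, norm_smul]
    congr 1
    norm_num
    ring
  rw [kernelLoss, h1, h2]
  ring

theorem isTranslationKernel_kernelLoss (hβ : IsCutoffAngular β) (hγ0 : 0 ≤ γ) :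
    IsTranslationKernel (kernelLoss γ β)
      (fun v => 6 * betaZero β * (‖v‖ ^ γ * Real.exp (-(1 / 4) * ‖v‖ ^ 2))) where
  measurable ζ := by unfold kernelLoss; fun_prop
  integrable := (integrable_rpow_mul_gaussian (by norm_num) (by linarith)).const_mul _
  nonneg v := by have := betaZero_pos hβ; positivity
  bound ζ v hv := by
    have := betaZero_pos hβ
    rw [kernelLoss_add, abs_mul, Real.abs_exp, abs_of_nonneg (by positivity)]
    have h := exp_neg_sq_le_one ‖ζ + (1 / 2 : ℝ) • v‖
    have h0 : 0 ≤ betaZero β * (‖v‖ ^ γ * Real.exp (-(1 / 4) * ‖v‖ ^ 2)) := by positivity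
    nlinarith
  lipschitz ζ₁ ζ₂ v hv := by
    have := betaZero_pos hβ
    rw [kernelLoss_add, kernelLoss_add, ← mul_sub, abs_mul, abs_of_nonneg (by positivity)]
    have h1 : |‖ζ₁ + (1 / 2 : ℝ) • v‖ - ‖ζ₂ + (1 / 2 : ℝ) • v‖| ≤ ‖ζ₁ - ζ₂‖ := by
      refine (abs_norm_sub_norm_le _ _).trans (le_of_eq ?_)
      rw [add_sub_add_right_eq_sub]
    calc _ ≤ betaZero β * (‖v‖ ^ γ * Real.exp (-(1 / 4) * ‖v‖ ^ 2)) * (6 * ‖ζ₁ - ζ₂‖) := by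
          gcongr
          exact (abs_exp_neg_sq_sub_le _ _).trans (by gcongr)
      _ = _ := by ring

/-- For fixed `v`, the velocity `ζ` enters only through its component along `v` and the length of
its orthogonal component, both Lipschitz in `ζ` uniformly in `v`. -/
theorem kernelGain_add (hv : v ≠ 0) (ζ : E3) : kernelGain γ β ζ (ζ + v) =
    (2 * Real.pi)⁻¹ * (‖v‖ ^ γ * Real.exp (-(1 / 4) * ‖v‖ ^ 2))
      * (Real.exp (-(‖v‖ / 2 + inner ℝ ζ v / ‖v‖) ^ 2)
        * angleIntegral γ β ‖v‖ (orthLength ζ v)) := by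
  have hv' : ‖v‖ ≠ 0 := norm_ne_zero_iff.2 hv
  have h1 : (‖ζ + v‖ ^ 2 - ‖ζ‖ ^ 2) / ‖v‖ = 2 * (‖v‖ / 2 + inner ℝ ζ v / ‖v‖) := by
    rw [norm_add_sq_real]; field_simp; ring
  rw [kernelGain, add_sub_cancel_left, h1]
  have h2 : Real.exp (-(‖v‖ ^ 2 + (2 * (‖v‖ / 2 + inner ℝ ζ v / ‖v‖)) ^ 2) / 4)
      = Real.exp (-(1 / 4) * ‖v‖ ^ 2) * Real.exp (-(‖v‖ / 2 + inner ℝ ζ v / ‖v‖) ^ 2) := by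
    rw [← Real.exp_add]; congr 1; ring
  rw [h2]
  simp only [angleIntegral, angleIntegrand]
  ring

theorem abs_orthLength_sub_le (hv : v ≠ 0) :
    |orthLength ζ₁ v - orthLength ζ₂ v| ≤ 2 * ‖ζ₁ - ζ₂‖ := by
  have hv' : 0 < ‖v‖ := norm_pos_iff.2 hv
  refine (abs_norm_sub_norm_le _ _).trans ?_
  have h1 : (ζ₁ - (inner ℝ ζ₁ v / ‖v‖ ^ 2) • v) - (ζ₂ - (inner ℝ ζ₂ v / ‖v‖ ^ 2) • v)
      = (ζ₁ - ζ₂) - (inner ℝ (ζ₁ - ζ₂) v / ‖v‖ ^ 2) • v := by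
    rw [inner_sub_left, sub_div, sub_smul]; abel
  rw [h1]
  refine (norm_sub_le _ _).trans ?_
  rw [norm_smul, Real.norm_eq_abs, abs_div, abs_of_pos (by positivity : 0 < ‖v‖ ^ 2)]
  have h2 : |inner ℝ (ζ₁ - ζ₂) v| / ‖v‖ ^ 2 * ‖v‖ ≤ ‖ζ₁ - ζ₂‖ := by
    have h3 := abs_real_inner_le_norm (ζ₁ - ζ₂) v
    rw [div_mul_eq_mul_div, div_le_iff₀ (by positivity)]
    nlinarith
  linarith

theorem abs_inner_div_sub_le (hv : v ≠ 0) :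
    |(‖v‖ / 2 + inner ℝ ζ₁ v / ‖v‖) - (‖v‖ / 2 + inner ℝ ζ₂ v / ‖v‖)| ≤ ‖ζ₁ - ζ₂‖ := by
  have hv' : 0 < ‖v‖ := norm_pos_iff.2 hv
  rw [add_sub_add_left_eq_sub, ← sub_div, ← inner_sub_left, abs_div, abs_of_pos hv',
    div_le_iff₀ hv']
  exact abs_real_inner_le_norm _ _

theorem measurable_kernelGain (hβ : Measurable β) (ζ : E3) : Measurable (kernelGain γ β ζ) := by
  have ht := measurable_tan
  have horth : Measurable fun η : E3 => orthLength ζ (η - ζ) := by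
    unfold orthLength; fun_prop
  have hint : Measurable fun η : E3 => ∫ θ in (0 : ℝ)..(Real.pi / 2), ∫ ε in (0 : ℝ)..(2 * Real.pi),
        (β θ + β (Real.pi / 2 - θ)) * Real.cos θ ^ (-(3 + γ))
          * Real.exp (-(orthLength ζ (η - ζ) ^ 2
              + 2 * orthLength ζ (η - ζ) * (‖η - ζ‖ * Real.tan θ) * Real.cos ε
              + (‖η - ζ‖ * Real.tan θ) ^ 2)) := by
    simp only [intervalIntegral.integral_of_le (by positivity : (0 : ℝ) ≤ Real.pi / 2),
      intervalIntegral.integral_of_le (by positivity : (0 : ℝ) ≤ 2 * Real.pi)]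
    have h1 : Measurable fun p : (E3 × ℝ) × ℝ =>
        (β p.1.2 + β (Real.pi / 2 - p.1.2)) * Real.cos p.1.2 ^ (-(3 + γ))
          * Real.exp (-(orthLength ζ (p.1.1 - ζ) ^ 2
              + 2 * orthLength ζ (p.1.1 - ζ) * (‖p.1.1 - ζ‖ * Real.tan p.1.2) * Real.cos p.2
              + (‖p.1.1 - ζ‖ * Real.tan p.1.2) ^ 2)) := by
      have horth' : Measurable fun p : (E3 × ℝ) × ℝ => orthLength ζ (p.1.1 - ζ) :=
        horth.comp (measurable_fst.comp measurable_fst)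
      fun_prop
    have h2 := (h1.stronglyMeasurable.integral_prod_right'
      (ν := volume.restrict (Ioc (0 : ℝ) (2 * Real.pi))))
    exact (h2.integral_prod_right' (ν := volume.restrict (Ioc (0 : ℝ) (Real.pi / 2)))).measurable
  unfold kernelGain
  exact Measurable.mul (by fun_prop) hint

theorem rpow_mul_inv_sq (hv : v ≠ 0) : ‖v‖ ^ γ * (‖v‖ ^ 2)⁻¹ = ‖v‖ ^ (γ - 2) := by
  rw [Real.rpow_sub (norm_pos_iff.2 hv), div_eq_mul_inv]
  norm_cast

theorem exists_isTranslationKernel_kernelGain (hβ : IsCutoffAngular β) (hγ0 : 0 ≤ γ)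
    (hγ1 : γ ≤ 1) : ∃ H, IsTranslationKernel (kernelGain γ β) H := by
  obtain ⟨C₀, hC₀⟩ := hβ.bound
  obtain ⟨C, hC, hβC⟩ : ∃ C : ℝ, 0 ≤ C ∧ ∀ θ ∈ Icc (0 : ℝ) (Real.pi / 2),
      β θ ≤ C * (Real.cos θ * Real.sin θ) := by
    refine ⟨|C₀|, abs_nonneg _, fun θ hθ => (hC₀ θ hθ).trans ?_⟩
    refine mul_le_mul_of_nonneg_right (le_abs_self _) (mul_nonneg ?_ ?_)
    · exact Real.cos_nonneg_of_mem_Icc ⟨by linarith [hθ.1, Real.pi_pos], hθ.2⟩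
    · exact Real.sin_nonneg_of_nonneg_of_le_pi hθ.1 (by linarith [hθ.2, Real.pi_pos])
  set P := (planeGaussian 1).toReal
  set Q := (planeGaussian (1 / 2)).toReal
  have hP : 0 ≤ P := ENNReal.toReal_nonneg
  have hQ : 0 ≤ Q := ENNReal.toReal_nonneg
  have hJ : ∀ ζ v : E3, v ≠ 0 →
      |angleIntegral γ β ‖v‖ (orthLength ζ v)| ≤ 2 * C * P * (‖v‖ ^ 2)⁻¹ := fun ζ v hv =>
    abs_angleIntegral_le hγ1 hβ.measurable hβ.nonneg hβC hC (norm_pos_iff.2 hv)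
  have hJL : ∀ ζ₁ ζ₂ v : E3, v ≠ 0 →
      |angleIntegral γ β ‖v‖ (orthLength ζ₁ v) - angleIntegral γ β ‖v‖ (orthLength ζ₂ v)|
        ≤ 24 * C * Q * ‖ζ₁ - ζ₂‖ * (‖v‖ ^ 2)⁻¹ := fun ζ₁ ζ₂ v hv => by
    refine (abs_angleIntegral_sub_le hγ1 hβ.measurable hβ.nonneg hβC hC
      (norm_pos_iff.2 hv)).trans ?_
    calc _ ≤ 12 * C * Q * (2 * ‖ζ₁ - ζ₂‖) * (‖v‖ ^ 2)⁻¹ := by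
          gcongr
          exact abs_orthLength_sub_le hv
      _ = _ := by ring
  have hH : ∀ (v : E3) (c : ℝ), v ≠ 0 →
      (2 * Real.pi)⁻¹ * (‖v‖ ^ γ * Real.exp (-(1 / 4) * ‖v‖ ^ 2)) * (c * (‖v‖ ^ 2)⁻¹)
        = (2 * Real.pi)⁻¹ * c * (‖v‖ ^ (γ - 2) * Real.exp (-(1 / 4) * ‖v‖ ^ 2)) := by
    intro v c hv
    rw [← rpow_mul_inv_sq hv]; ring
  -- `12CP` is the Lipschitz constant `6` of the Gaussian times the bound `2CP` of the angular
  -- integral. `24CQ` is the Lipschitz constant of the angular integral in `ζ`. Since `γ - 2 > -3`,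
  -- the weight is integrable.
  refine ⟨fun v => (2 * Real.pi)⁻¹ * (12 * C * P + 24 * C * Q)
    * (‖v‖ ^ (γ - 2) * Real.exp (-(1 / 4) * ‖v‖ ^ 2)), measurable_kernelGain hβ.measurable,
    (integrable_rpow_mul_gaussian (by norm_num) (by linarith)).const_mul _,
    fun v => by positivity, fun ζ v hv => ?_, fun ζ₁ ζ₂ v hv => ?_⟩
  · rw [kernelGain_add hv, abs_mul, abs_mul (Real.exp _), Real.abs_exp,
      abs_of_nonneg (by positivity), ← hH v _ hv]
    refine mul_le_mul_of_nonneg_left ?_ (by positivity)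
    calc _ ≤ 1 * (2 * C * P * (‖v‖ ^ 2)⁻¹) :=
          mul_le_mul (exp_neg_sq_le_one _) (hJ ζ v hv) (abs_nonneg _) zero_le_one
      _ ≤ _ := by
        rw [one_mul]
        gcongr
        have h1 : 0 ≤ C * P := by positivity
        have h2 : 0 ≤ C * Q := by positivity
        linarith
  · rw [kernelGain_add hv, kernelGain_add hv, ← mul_sub, abs_mul, abs_of_nonneg (by positivity),
      ← hH v _ hv, mul_left_comm ‖ζ₁ - ζ₂‖]
    refine mul_le_mul_of_nonneg_left ?_ (by positivity)
    have hφ := (abs_exp_neg_sq_sub_le (‖v‖ / 2 + inner ℝ ζ₁ v / ‖v‖)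
      (‖v‖ / 2 + inner ℝ ζ₂ v / ‖v‖)).trans
        (mul_le_mul_of_nonneg_left (abs_inner_div_sub_le hv) (by norm_num))
    have hφ1 := exp_neg_sq_le_one (‖v‖ / 2 + inner ℝ ζ₂ v / ‖v‖)
    have hφ0 := Real.exp_pos (-(‖v‖ / 2 + inner ℝ ζ₂ v / ‖v‖) ^ 2)
    have hJ1 := hJ ζ₁ v hv
    have hJ2 := hJL ζ₁ ζ₂ v hv
    generalize Real.exp (-(‖v‖ / 2 + inner ℝ ζ₁ v / ‖v‖) ^ 2) = φ₁ at *
    generalize Real.exp (-(‖v‖ / 2 + inner ℝ ζ₂ v / ‖v‖) ^ 2) = φ₂ at *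
    generalize angleIntegral γ β ‖v‖ (orthLength ζ₁ v) = J₁ at *
    generalize angleIntegral γ β ‖v‖ (orthLength ζ₂ v) = J₂ at *
    calc |φ₁ * J₁ - φ₂ * J₂| = |(φ₁ - φ₂) * J₁ + φ₂ * (J₁ - J₂)| := by congr 1; ring
      _ ≤ |φ₁ - φ₂| * |J₁| + φ₂ * |J₁ - J₂| := by
        refine (abs_add_le _ _).trans (le_of_eq ?_)
        rw [abs_mul, abs_mul, abs_of_pos hφ0]
      _ ≤ (6 * ‖ζ₁ - ζ₂‖) * (2 * C * P * (‖v‖ ^ 2)⁻¹)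
          + 1 * (24 * C * Q * ‖ζ₁ - ζ₂‖ * (‖v‖ ^ 2)⁻¹) := by gcongr
      _ = _ := by ring

theorem exists_isTranslationKernel_collisionKernel (hβ : IsCutoffAngular β) (hγ0 : 0 ≤ γ)
    (hγ1 : γ ≤ 1) : ∃ H, IsTranslationKernel (collisionKernel γ β) H := by
  obtain ⟨H, hH⟩ := exists_isTranslationKernel_kernelGain hβ hγ0 hγ1
  exact ⟨_, hH.sub (isTranslationKernel_kernelLoss hβ hγ0)⟩

end LinBoltzmann

namespace LinBoltzmann

/-! ### Integrals over the flight times -/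

theorem measurableSet_flightTimes (Ω : Set E3) (x ζ : E3) :
    MeasurableSet (flightTimes Ω x ζ) :=
  measurableSet_Ioi.inter (measurableSet_lt ENNReal.measurable_ofReal measurable_const)

theorem flightTimes_of_top {Ω : Set E3} {x ζ : E3} (h : tauMinus Ω x ζ = ∞) :
    flightTimes Ω x ζ = Ioi 0 := by
  ext s; simp [flightTimes, h]

theorem flightTimes_of_ne_top {Ω : Set E3} {x ζ : E3} (h : tauMinus Ω x ζ ≠ ∞) :
    flightTimes Ω x ζ = Ioo 0 (tauMinus Ω x ζ).toReal := by
  ext s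
  simp only [flightTimes, mem_ofPred_eq, mem_Ioo]
  refine and_congr_right fun hs => ?_
  exact ENNReal.ofReal_lt_iff_lt_toReal hs.le h

theorem flightTimes_subset_Ioi {Ω : Set E3} {x ζ : E3} : flightTimes Ω x ζ ⊆ Ioi 0 :=
  fun _ hs => hs.1

theorem flightTimes_mono {Ω : Set E3} {x y ζ₁ ζ₂ : E3}
    (h : tauMinus Ω x ζ₁ ≤ tauMinus Ω y ζ₂) : flightTimes Ω x ζ₁ ⊆ flightTimes Ω y ζ₂ :=
  fun _ hs => ⟨hs.1, hs.2.trans_le h⟩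

variable {γ : ℝ} {β : ℝ → ℝ} {Ω : Set E3} {f : E3 → E3 → ℝ} {A M σ D ν₀ L d c : ℝ}
  {x y ζ ζ₁ ζ₂ : E3} {H : E3 → ℝ}

theorem integrableOn_exp_flightTimes (hc : 0 < c) :
    IntegrableOn (fun s => Real.exp (-(c * s))) (flightTimes Ω x ζ) := by
  have h := exp_neg_integrableOn_Ioi 0 hc
  simp only [neg_mul] at h
  exact h.mono_set flightTimes_subset_Ioi

theorem integral_exp_flightTimes (hc : 0 < c) :
    ∫ s in flightTimes Ω x ζ, Real.exp (-(c * s))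
      = (1 - survival c (tauMinus Ω x ζ)) / c := by
  by_cases h : tauMinus Ω x ζ = ∞
  · rw [flightTimes_of_top h, h, survival_top, sub_zero]
    have := integral_exp_mul_Ioi (a := -c) (by linarith) 0
    simp only [neg_mul] at this
    rw [this]; simp
  · rw [flightTimes_of_ne_top h, survival_of_ne h, ← integral_Ioc_eq_integral_Ioo,
      ← intervalIntegral.integral_of_le ENNReal.toReal_nonneg]
    set t := (tauMinus Ω x ζ).toReal
    have hd : ∀ s ∈ uIcc 0 t, HasDerivAt (fun s => -(Real.exp (-(c * s)) / c))
        (Real.exp (-(c * s))) s := by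
      intro s _
      have h1 : HasDerivAt (fun s : ℝ => -(c * s)) (-c) s :=
        ((hasDerivAt_id s).const_mul c).neg.congr_deriv (by simp)
      exact (h1.exp.div_const c).neg.congr_deriv (by field_simp)
    rw [intervalIntegral.integral_eq_sub_of_hasDerivAt hd
      (Continuous.intervalIntegrable (by fun_prop) _ _)]
    simp
    ring

/-- A majorant of `s ↦ e^{-c s} (1 - s / t)^{-σ}`; for `t = 0` it is a pure exponential. -/
noncomputable def decayMajorant (c σ t s : ℝ) : ℝ :=
  2 * Real.exp (-(c * s)) + 2 / (c * t) * (1 - s / t) ^ (-σ)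

/-- On the first half of the flight the power is at most `2`; on the second half `e^{-cs} ≤ 1/(cs) ≤
2/(ct)`. The factor `1/t` cancels the `t` in `∫ (1 - s/t)^{-σ} ds = t/(1 - σ)`, so the integral is
bounded uniformly in `t`. -/
theorem le_decayMajorant (hc : 0 < c) (hσ0 : 0 ≤ σ) (hσ1 : σ ≤ 1) {s : ℝ}
    (hs : s ∈ flightTimes Ω x ζ) :
    Real.exp (-(c * s)) * (1 - s / (tauMinus Ω x ζ).toReal) ^ (-σ)
      ≤ decayMajorant c σ (tauMinus Ω x ζ).toReal s := by
  have he := Real.exp_pos (-(c * s))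
  unfold decayMajorant
  by_cases h : tauMinus Ω x ζ = ∞
  -- For an infinite flight `t` reads as `0`, both quotients by it vanish, and only the pure
  -- exponential remains.
  · simp only [h, ENNReal.toReal_top, div_zero, sub_zero, Real.one_rpow, mul_zero]
    linarith
  rw [flightTimes_of_ne_top h] at hs
  set t := (tauMinus Ω x ζ).toReal
  have ht : 0 < t := hs.1.trans hs.2
  have hu : 0 < 1 - s / t := by rw [sub_pos, div_lt_one ht]; exact hs.2
  have hp : 0 < (1 - s / t) ^ (-σ) := by positivity
  rcases le_total s (t / 2) with h2 | h2
  · have h3 : 1 / 2 ≤ 1 - s / t := by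
      have : s / t ≤ 1 / 2 := by rw [div_le_iff₀ ht]; linarith
      linarith
    have h4 : (1 - s / t) ^ (-σ) ≤ 2 := by
      calc (1 - s / t) ^ (-σ) ≤ (1 / 2 : ℝ) ^ (-σ) :=
            Real.rpow_le_rpow_of_nonpos (by norm_num) h3 (by linarith)
        _ = (2 : ℝ) ^ σ := by
          rw [one_div, Real.inv_rpow (by norm_num), Real.rpow_neg (by norm_num), inv_inv]
        _ ≤ 2 ^ (1 : ℝ) := Real.rpow_le_rpow_of_exponent_le (by norm_num) hσ1
        _ = 2 := Real.rpow_one _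
    have h5 : 0 ≤ 2 / (c * t) * (1 - s / t) ^ (-σ) := by positivity
    nlinarith
  · have h3 : Real.exp (-(c * s)) ≤ 2 / (c * t) := by
      have h4 := mul_exp_neg_le_one (c * s)
      rw [le_div_iff₀ (by positivity)]
      have : c * (t / 2) ≤ c * s := by gcongr
      nlinarith
    have := mul_le_mul_of_nonneg_right h3 hp.le
    linarith

theorem integral_one_sub_div_rpow {t : ℝ} (ht : 0 < t) (hσ1 : σ < 1) :
    ∫ s in (0 : ℝ)..t, (1 - s / t) ^ (-σ) = t / (1 - σ) := by
  rw [intervalIntegral.integral_comp_sub_div (fun u : ℝ => u ^ (-σ)) ht.ne' 1, div_self ht.ne',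
    zero_div, sub_self, sub_zero, integral_rpow (Or.inl (by linarith)), smul_eq_mul,
    Real.one_rpow, Real.zero_rpow (by linarith), sub_zero]
  rw [neg_add_eq_sub]
  ring

theorem integrableOn_decayMajorant (hc : 0 < c) (hσ1 : σ < 1) :
    IntegrableOn (decayMajorant c σ (tauMinus Ω x ζ).toReal) (flightTimes Ω x ζ) ∧
    ∫ s in flightTimes Ω x ζ, decayMajorant c σ (tauMinus Ω x ζ).toReal s
      ≤ 2 / c + 2 / (c * (1 - σ)) := by
  have hσ' : 0 < 1 - σ := by linarith
  have h1 := (integrableOn_exp_flightTimes (Ω := Ω) (x := x) (ζ := ζ) hc).const_mul 2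
  have h1' : ∫ s in flightTimes Ω x ζ, 2 * Real.exp (-(c * s)) ≤ 2 / c := by
    rw [integral_const_mul, integral_exp_flightTimes hc, ← mul_div_assoc]
    have := survival_nonneg c (tauMinus Ω x ζ)
    gcongr
    linarith
  have h2 : IntegrableOn (fun s => 2 / (c * (tauMinus Ω x ζ).toReal)
      * (1 - s / (tauMinus Ω x ζ).toReal) ^ (-σ)) (flightTimes Ω x ζ) ∧
      ∫ s in flightTimes Ω x ζ, 2 / (c * (tauMinus Ω x ζ).toReal)
      * (1 - s / (tauMinus Ω x ζ).toReal) ^ (-σ) ≤ 2 / (c * (1 - σ)) := by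
    by_cases h : tauMinus Ω x ζ = ∞
    · simp only [h, ENNReal.toReal_top, mul_zero, div_zero, zero_mul, integral_zero]
      exact ⟨integrableOn_zero, by positivity⟩
    · rw [flightTimes_of_ne_top h]
      have ht0 : 0 ≤ (tauMinus Ω x ζ).toReal := ENNReal.toReal_nonneg
      rcases ht0.eq_or_lt with ht | ht
      · rw [← ht]; simp; positivity
      set t := (tauMinus Ω x ζ).toReal
      have hint := integral_one_sub_div_rpow ht hσ1
      -- A non-integrable function would have integral `0` by convention, whereas the computed value
      -- is positive.
      have hii : IntervalIntegrable (fun s : ℝ => (1 - s / t) ^ (-σ)) volume 0 t :=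
        intervalIntegral.intervalIntegrable_of_integral_ne_zero (by rw [hint]; positivity)
      rw [intervalIntegrable_iff_integrableOn_Ioo_of_le ht.le] at hii
      refine ⟨hii.const_mul _, ?_⟩
      rw [integral_const_mul, ← integral_Ioc_eq_integral_Ioo,
        ← intervalIntegral.integral_of_le ht.le, hint]
      apply le_of_eq
      field_simp
  refine ⟨h1.add h2.1, ?_⟩
  unfold decayMajorant
  rw [integral_add h1 h2.1]
  exact add_le_add h1' h2.2

/-! ### The velocity integral -/

/-- The velocity integral `∫ k(ζ, η) I(z, η) dη` inside `II`. -/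
noncomputable def velocityIntegral (γ : ℝ) (β : ℝ → ℝ) (Ω : Set E3) (f : E3 → E3 → ℝ)
    (z ζ : E3) : ℝ :=
  ∫ η : E3, collisionKernel γ β ζ η * termI γ β Ω f z η

theorem integrable_collisionKernel (hk : IsTranslationKernel (collisionKernel γ β) H) (ζ : E3) :
    Integrable (collisionKernel γ β ζ) := by
  have h : Integrable (fun v => collisionKernel γ β ζ (ζ + v)) := by
    refine hk.integrable.mono' ((hk.measurable ζ).comp (measurable_const_add ζ)).aestronglyMeasurable ?_
    have hne : ∀ᵐ v : E3, v ≠ 0 := by simp [ae_iff]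
    filter_upwards [hne] with v hv using hk.bound ζ v hv
  simpa using h.comp_add_left (-ζ)

/-- The standing assumptions on domain, frequency, kernel and boundary data. -/
structure Setting (γ : ℝ) (β : ℝ → ℝ) (Ω : Set E3) (f : E3 → E3 → ℝ) (H : E3 → ℝ)
    (A M σ D ν₀ L : ℝ) : Prop where
  domain : IsConvexDomain Ω D
  frequency : IsFrequency (nu γ β) ν₀ L
  data : IsHolderData Ω A M σ f
  kernel : IsTranslationKernel (collisionKernel γ β) H
  A_nonneg : 0 ≤ A
  M_nonneg : 0 ≤ M
  D_nonneg : 0 ≤ D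
  L_nonneg : 0 ≤ L
  σ_pos : 0 < σ
  σ_lt : σ < 1

namespace Setting

theorem continuousOn_termI (S : Setting γ β Ω f H A M σ D ν₀ L) :
    ContinuousOn (fun q : E3 × E3 => termI γ β Ω f q.1 q.2) (Ω ×ˢ univ) :=
  LinBoltzmann.continuousOn_termI S.domain S.frequency S.data S.A_nonneg S.M_nonneg S.D_nonneg
    S.L_nonneg S.σ_pos S.σ_lt.le

theorem abs_termI_le (S : Setting γ β Ω f H A M σ D ν₀ L) (hx : x ∈ Ω) (ζ : E3) :
    |termI γ β Ω f x ζ| ≤ A :=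
  LinBoltzmann.abs_termI_le S.domain S.frequency S.data S.A_nonneg hx

theorem continuous_termI (S : Setting γ β Ω f H A M σ D ν₀ L) (hx : x ∈ Ω) :
    Continuous (termI γ β Ω f x) :=
  S.continuousOn_termI.comp_continuous (f := fun ζ : E3 => (x, ζ)) (by fun_prop)
    fun _ => ⟨hx, mem_univ _⟩

theorem integrable_velocity (S : Setting γ β Ω f H A M σ D ν₀ L) (hx : x ∈ Ω) (ζ : E3) :
    Integrable (fun η => collisionKernel γ β ζ η * termI γ β Ω f x η) :=
  (integrable_collisionKernel S.kernel ζ).mul_bdd (c := A)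
    (S.continuous_termI hx).aestronglyMeasurable (Eventually.of_forall fun η => S.abs_termI_le hx η)

/-- In the relative velocity `v` the singularity of the kernel no longer moves with `ζ`, so
integrals for different `ζ` can be compared pointwise. -/
theorem velocityIntegral_eq (ζ : E3) : velocityIntegral γ β Ω f x ζ =
    ∫ v : E3, collisionKernel γ β ζ (ζ + v) * termI γ β Ω f x (ζ + v) :=
  (integral_add_left_eq_self (fun η => collisionKernel γ β ζ η * termI γ β Ω f x η) ζ).symm

theorem integrable_velocity_add (S : Setting γ β Ω f H A M σ D ν₀ L) (hx : x ∈ Ω) (ζ : E3) :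
    Integrable (fun v => collisionKernel γ β ζ (ζ + v) * termI γ β Ω f x (ζ + v)) :=
  (S.integrable_velocity hx ζ).comp_add_left ζ

theorem ae_ne_zero : ∀ᵐ v : E3, v ≠ 0 := by simp [ae_iff]

theorem abs_velocityIntegral_le (S : Setting γ β Ω f H A M σ D ν₀ L) (hx : x ∈ Ω) (ζ : E3) :
    |velocityIntegral γ β Ω f x ζ| ≤ A * ∫ v, H v := by
  rw [velocityIntegral_eq, ← Real.norm_eq_abs, ← integral_const_mul]
  refine norm_integral_le_of_norm_le (S.kernel.integrable.const_mul A) ?_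
  filter_upwards [ae_ne_zero] with v hv
  rw [Real.norm_eq_abs, abs_mul, mul_comm]
  exact mul_le_mul (S.abs_termI_le hx _) (S.kernel.bound ζ v hv) (abs_nonneg _) S.A_nonneg

/-- The Hölder constant of the velocity integral. -/
noncomputable def holderConstG (H : E3 → ℝ) (A M D ν₀ L : ℝ) : ℝ :=
  (2 * A + holderConstI A M D ν₀ L) * ∫ v, H v

/-- At equal `v` the arguments `ζ₁ + v` and `ζ₂ + v` of the boundary term still differ by `ζ₁ - ζ₂`,
so its Hölder bound is uniform in `v`. The increments of kernel and boundary term are then both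
integrated against `H`. -/
theorem abs_velocityIntegral_sub_le (S : Setting γ β Ω f H A M σ D ν₀ L) (hd : 0 < d)
    (hx : x ∈ Ω) (hy : y ∈ Ω) (hxd : Metric.ball x d ⊆ Ω) (hyd : Metric.ball y d ⊆ Ω) :
    |velocityIntegral γ β Ω f x ζ₁ - velocityIntegral γ β Ω f y ζ₂|
      ≤ holderConstG H A M D ν₀ L * ((‖x - y‖ + ‖ζ₁ - ζ₂‖) * (1 + d⁻¹)) ^ σ := by
  have hdd : 0 < d⁻¹ := inv_pos.2 hd
  rw [velocityIntegral_eq, velocityIntegral_eq,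
    ← integral_sub (S.integrable_velocity_add hx ζ₁) (S.integrable_velocity_add hy ζ₂),
    ← Real.norm_eq_abs]
  set Q := ((‖x - y‖ + ‖ζ₁ - ζ₂‖) * (1 + d⁻¹)) ^ σ with hQ
  have hIle : ∀ v, |termI γ β Ω f x (ζ₁ + v) - termI γ β Ω f y (ζ₂ + v)|
      ≤ holderConstI A M D ν₀ L * Q := fun v => by
    have h := LinBoltzmann.abs_termI_sub_le (ζ₁ := ζ₁ + v) (ζ₂ := ζ₂ + v) S.domain S.frequency
      S.data S.A_nonneg S.M_nonneg S.D_nonneg S.L_nonneg S.σ_pos.le S.σ_lt.le hd hx hy hxd hyd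
    rwa [add_sub_add_right_eq_sub] at h
  have hζQ : ‖ζ₁ - ζ₂‖ ^ σ ≤ Q := by
    refine Real.rpow_le_rpow (norm_nonneg _) ?_ S.σ_pos.le
    nlinarith [norm_nonneg (x - y), norm_nonneg (ζ₁ - ζ₂),
      mul_nonneg (norm_nonneg (x - y)) hdd.le, mul_nonneg (norm_nonneg (ζ₁ - ζ₂)) hdd.le]
  refine (norm_integral_le_of_norm_le
    (S.kernel.integrable.const_mul ((2 * A + holderConstI A M D ν₀ L) * Q)) ?_).trans (le_of_eq ?_)
  · filter_upwards [ae_ne_zero] with v hv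
    have hb1 := S.kernel.bound ζ₁ v hv
    have hb2 := S.kernel.bound ζ₂ v hv
    have hH := S.kernel.nonneg v
    -- Interpolation between the size bound `2H` and the Lipschitz bound turns the kernel estimate
    -- into one of order `σ`.
    have hK : |collisionKernel γ β ζ₁ (ζ₁ + v) - collisionKernel γ β ζ₂ (ζ₂ + v)|
        ≤ 2 * H v * Q := by
      refine (le_mul_rpow_of_le_min (B := 2 * H v) (t := ‖ζ₁ - ζ₂‖) (c := 1) (x := ‖ζ₁ - ζ₂‖)
        (by positivity) le_rfl (norm_nonneg _) S.σ_pos.le S.σ_lt.le ?_ ?_ (by rw [one_mul])).trans ?_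
      · exact (abs_sub _ _).trans (by linarith)
      · refine (S.kernel.lipschitz ζ₁ ζ₂ v hv).trans ?_
        nlinarith [mul_nonneg (norm_nonneg (ζ₁ - ζ₂)) hH]
      · rw [one_mul]; gcongr
    have hI := hIle v
    have hI1 := S.abs_termI_le hx (ζ₁ + v)
    rw [Real.norm_eq_abs]
    generalize collisionKernel γ β ζ₁ (ζ₁ + v) = k₁ at *
    generalize collisionKernel γ β ζ₂ (ζ₂ + v) = k₂ at *
    generalize termI γ β Ω f x (ζ₁ + v) = i₁ at *
    generalize termI γ β Ω f y (ζ₂ + v) = i₂ at *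
    calc |k₁ * i₁ - k₂ * i₂| = |(k₁ - k₂) * i₁ + k₂ * (i₁ - i₂)| := by congr 1; ring
      _ ≤ |k₁ - k₂| * |i₁| + |k₂| * |i₁ - i₂| := by
        refine (abs_add_le _ _).trans (le_of_eq ?_)
        rw [abs_mul, abs_mul]
      _ ≤ (2 * H v * Q) * A + H v * (holderConstI A M D ν₀ L * Q) :=
        add_le_add (mul_le_mul hK hI1 (abs_nonneg _) ((abs_nonneg _).trans hK))
          (mul_le_mul hb2 hI (abs_nonneg _) hH)
      _ = _ := by ring
  · rw [integral_const_mul, holderConstG]; ring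

/-! ### The iterated term -/

theorem frequency_pos (S : Setting γ β Ω f H A M σ D ν₀ L) (ζ : E3) : 0 < nu γ β ζ :=
  S.frequency.pos.trans_le (S.frequency.lower ζ)

theorem mem_of_flightTimes (S : Setting γ β Ω f H A M σ D ν₀ L) (hx : x ∈ Ω) {s : ℝ}
    (hs : s ∈ flightTimes Ω x ζ) : x - s • ζ ∈ Ω :=
  sub_smul_mem_of_lt_tauMinus S.domain.isOpen hx hs.1.le hs.2

/-- The factor `e^{-νs} k(ζ, η)` is a product of integrable functions, and the boundary term is
bounded by `A` and continuous along the flight. -/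
theorem integrable_integrandII (S : Setting γ β Ω f H A M σ D ν₀ L) (hx : x ∈ Ω) (ζ : E3) :
    Integrable (fun q : ℝ × E3 => integrandII γ β Ω f x ζ q.1 q.2)
      ((volume.restrict (flightTimes Ω x ζ)).prod volume) := by
  have h1 := (integrableOn_exp_flightTimes (Ω := Ω) (x := x) (ζ := ζ)
    (S.frequency_pos ζ)).mul_prod (integrable_collisionKernel S.kernel ζ)
  refine h1.mul_bdd (c := A) ?_ ?_
  · rw [← Measure.restrict_univ (μ := (volume : Measure E3)), Measure.prod_restrict]
    refine ContinuousOn.aestronglyMeasurable ?_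
      ((measurableSet_flightTimes Ω x ζ).prod MeasurableSet.univ)
    exact S.continuousOn_termI.comp (f := fun q : ℝ × E3 => (x - q.1 • ζ, q.2)) (by fun_prop)
      fun q hq => ⟨S.mem_of_flightTimes hx hq.1, mem_univ _⟩
  · rw [← Measure.restrict_univ (μ := (volume : Measure E3)), Measure.prod_restrict]
    filter_upwards [ae_restrict_mem ((measurableSet_flightTimes Ω x ζ).prod MeasurableSet.univ)]
      with q hq
    exact S.abs_termI_le (S.mem_of_flightTimes hx hq.1) _

/-- The integrand of `II` after the velocity integration. -/
noncomputable def flightIntegrand (γ : ℝ) (β : ℝ → ℝ) (Ω : Set E3) (f : E3 → E3 → ℝ) (x ζ : E3)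
    (s : ℝ) : ℝ :=
  Real.exp (-(nu γ β ζ * s)) * velocityIntegral γ β Ω f (x - s • ζ) ζ

theorem integral_integrandII (s : ℝ) : ∫ η : E3, integrandII γ β Ω f x ζ s η =
    flightIntegrand γ β Ω f x ζ s := by
  simp only [integrandII, mul_assoc, flightIntegrand, velocityIntegral, integral_const_mul]

theorem integrableOn_flightIntegrand (S : Setting γ β Ω f H A M σ D ν₀ L) (hx : x ∈ Ω) (ζ : E3) :
    IntegrableOn (flightIntegrand γ β Ω f x ζ) (flightTimes Ω x ζ) := by
  have h := (S.integrable_integrandII hx ζ).integral_prod_left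
  simp only [integral_integrandII] at h
  exact h

theorem termII_eq : termII γ β Ω f x ζ = ∫ s in flightTimes Ω x ζ, flightIntegrand γ β Ω f x ζ s := by
  simp only [termII, integral_integrandII]

/-- The velocity integral is bounded, and integrating `e^{-ν₂s}` over the surplus times gives a
difference of survival factors divided by `ν₂`, to which the cone estimate applies. -/
theorem abs_tail_le (S : Setting γ β Ω f H A M σ D ν₀ L) (hd : 0 < d)
    (hy : y ∈ Ω) (hyd : Metric.ball y d ⊆ Ω)
    (hτ : tauMinus Ω x ζ₁ ≤ tauMinus Ω y ζ₂) :
    |∫ s in flightTimes Ω y ζ₂ \ flightTimes Ω x ζ₁, flightIntegrand γ β Ω f y ζ₂ s|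
      ≤ A * (∫ v, H v) * (4 * (1 + (ν₀ / 2)⁻¹) / ν₀)
        * ((‖x - y‖ + ‖ζ₁ - ζ₂‖) * (1 + d⁻¹)) ^ σ := by
  have hν₀ := S.frequency.pos
  have hν := S.frequency_pos ζ₂
  have hdd : 0 < d⁻¹ := inv_pos.2 hd
  have hG : 0 ≤ A * ∫ v, H v := mul_nonneg S.A_nonneg (integral_nonneg S.kernel.nonneg)
  have hei := integrableOn_exp_flightTimes (Ω := Ω) (x := y) (ζ := ζ₂) hν
  have h1 : |∫ s in flightTimes Ω y ζ₂ \ flightTimes Ω x ζ₁, flightIntegrand γ β Ω f y ζ₂ s|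
      ≤ ∫ s in flightTimes Ω y ζ₂ \ flightTimes Ω x ζ₁,
        (A * ∫ v, H v) * Real.exp (-(nu γ β ζ₂ * s)) := by
    rw [← Real.norm_eq_abs]
    refine norm_integral_le_of_norm_le ((hei.mono_set sdiff_subset).const_mul _) ?_
    filter_upwards [ae_restrict_mem ((measurableSet_flightTimes Ω y ζ₂).diff
      (measurableSet_flightTimes Ω x ζ₁))] with s hs
    rw [flightIntegrand, Real.norm_eq_abs, abs_mul, Real.abs_exp, mul_comm]
    gcongr
    exact S.abs_velocityIntegral_le (S.mem_of_flightTimes hy hs.1) ζ₂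
  refine h1.trans ?_
  rw [integral_const_mul, setIntegral_sdiff (measurableSet_flightTimes Ω x ζ₁) hei
    (flightTimes_mono hτ), integral_exp_flightTimes hν, integral_exp_flightTimes hν, ← sub_div,
    sub_sub_sub_cancel_left, mul_assoc _ (_ / ν₀)]
  refine mul_le_mul_of_nonneg_left ?_ hG
  by_cases hτ1 : tauMinus Ω x ζ₁ = ∞
  · have hτ2 : tauMinus Ω y ζ₂ = ∞ := top_le_iff.1 (hτ1 ▸ hτ)
    rw [hτ1, hτ2, sub_self, zero_div]
    positivity
  · have h2 := survival_tauMinus_sub_le S.domain hν₀ (S.frequency.lower ζ₂) S.σ_pos.le S.σ_lt.le hd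
      hy hyd hτ hτ1
    rw [div_mul_eq_mul_div]
    exact div_le_div₀ (by positivity) h2 hν₀ (S.frequency.lower ζ₂)

/-- The transported ball shrinks faster on the shorter flight, so the radius available there serves
for both trajectories. -/
theorem one_sub_div_le (hτ : tauMinus Ω x ζ₁ ≤ tauMinus Ω y ζ₂) {s : ℝ}
    (hs : s ∈ flightTimes Ω x ζ₁) :
    1 - s / (tauMinus Ω x ζ₁).toReal ≤ 1 - s / (tauMinus Ω y ζ₂).toReal := by
  by_cases h2 : tauMinus Ω y ζ₂ = ∞
  · rw [h2, ENNReal.toReal_top, div_zero]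
    have := div_nonneg hs.1.le (tauMinus Ω x ζ₁).toReal_nonneg
    linarith
  · have h1 := ne_top_of_le_ne_top h2 hτ
    have hs' := hs
    rw [flightTimes_of_ne_top h1] at hs'
    have ht1 : 0 < (tauMinus Ω x ζ₁).toReal := hs'.1.trans hs'.2
    have := ENNReal.toReal_mono h2 hτ
    have := hs.1.le
    gcongr

theorem one_sub_div_pos {s : ℝ} (hs : s ∈ flightTimes Ω x ζ) :
    0 < 1 - s / (tauMinus Ω x ζ).toReal := by
  by_cases h : tauMinus Ω x ζ = ∞
  · rw [h]; simp
  · rw [flightTimes_of_ne_top h] at hs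
    rw [sub_pos, div_lt_one (hs.1.trans hs.2)]
    exact hs.2

/-- Applied with `u = 1 - s/t`, the fraction of the initial radius left at time `s`. The loss
separates as `u^{-σ}`, the singularity to be integrated in time. -/
theorem scaled_holder_le {s u δ z : ℝ} (hd : 0 < d) (hσ0 : 0 ≤ σ) (hσ1 : σ ≤ 1) (hs : 0 ≤ s)
    (hu0 : 0 < u) (hu1 : u ≤ 1) (hδ : 0 ≤ δ) (hz0 : 0 ≤ z) (hz : z ≤ (1 + s) * δ) :
    (z * (1 + (u * d)⁻¹)) ^ σ ≤ (1 + s) * (u ^ (-σ) * (δ * (1 + d⁻¹)) ^ σ) := by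
  have hdd : 0 < d⁻¹ := inv_pos.2 hd
  have huu : 1 ≤ u⁻¹ := (one_le_inv₀ hu0).2 hu1
  have h1 : 1 + (u * d)⁻¹ ≤ u⁻¹ * (1 + d⁻¹) := by
    rw [mul_inv]; nlinarith
  calc (z * (1 + (u * d)⁻¹)) ^ σ ≤ ((1 + s) * (u⁻¹ * (δ * (1 + d⁻¹)))) ^ σ := by
        refine Real.rpow_le_rpow (by positivity) ?_ hσ0
        calc _ ≤ ((1 + s) * δ) * (u⁻¹ * (1 + d⁻¹)) := by gcongr
          _ = _ := by ring
    _ ≤ (1 + s) * (u⁻¹ * (δ * (1 + d⁻¹))) ^ σ :=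
        mul_rpow_le_of_one_le (by linarith) (by positivity) hσ1
    _ = _ := by
        rw [Real.mul_rpow (by positivity) (by positivity), Real.inv_rpow hu0.le,
          Real.rpow_neg hu0.le]

end Setting

end LinBoltzmann

/-! ### Hölder estimate for the iterated term -/

namespace LinBoltzmann

variable {γ : ℝ} {β : ℝ → ℝ} {Ω : Set E3} {f : E3 → E3 → ℝ} {A M σ D ν₀ L d c : ℝ}
  {x y ζ ζ₁ ζ₂ : E3} {H : E3 → ℝ}

namespace Setting

/-- Half of the decay absorbs the linear growth; the other half is kept for integration in time. -/
theorem one_add_mul_exp_le_mul_exp {s : ℝ} (hν₀ : 0 < ν₀) (hs : 0 ≤ s) :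
    (1 + s) * Real.exp (-(ν₀ * s)) ≤ (1 + (ν₀ / 2)⁻¹) * Real.exp (-(ν₀ / 2 * s)) := by
  have h : Real.exp (-(ν₀ * s)) = Real.exp (-(ν₀ / 2 * s)) * Real.exp (-(ν₀ / 2 * s)) := by
    rw [← Real.exp_add]; congr 1; ring
  rw [h, ← mul_assoc]
  gcongr
  exact one_add_mul_exp_le (half_pos hν₀) hs

theorem integral_H_nonneg (S : Setting γ β Ω f H A M σ D ν₀ L) : 0 ≤ ∫ v, H v :=
  integral_nonneg S.kernel.nonneg

theorem holderConstG_nonneg (S : Setting γ β Ω f H A M σ D ν₀ L) :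
    0 ≤ holderConstG H A M D ν₀ L := by
  have h1 := holderConstI_nonneg S.A_nonneg S.M_nonneg S.D_nonneg S.frequency.pos S.L_nonneg
  have h2 := S.A_nonneg
  have h3 := S.integral_H_nonneg
  unfold holderConstG
  positivity

theorem norm_trajectory_sub_le {s : ℝ} (hs : 0 ≤ s) :
    ‖(x - s • ζ₁) - (y - s • ζ₂)‖ + ‖ζ₁ - ζ₂‖ ≤ (1 + s) * (‖x - y‖ + ‖ζ₁ - ζ₂‖) := by
  have h : (x - s • ζ₁) - (y - s • ζ₂) = (x - y) - s • (ζ₁ - ζ₂) := by rw [smul_sub]; abel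
  have h2 := norm_sub_le (x - y) (s • (ζ₁ - ζ₂))
  rw [norm_smul, Real.norm_of_nonneg hs] at h2
  rw [h]
  nlinarith [mul_nonneg hs (norm_nonneg (x - y))]

theorem abs_velocityIntegral_flight_sub_le (S : Setting γ β Ω f H A M σ D ν₀ L) (hd : 0 < d)
    (hx : x ∈ Ω) (hy : y ∈ Ω) (hxd : Metric.ball x d ⊆ Ω) (hyd : Metric.ball y d ⊆ Ω)
    (hτ : tauMinus Ω x ζ₁ ≤ tauMinus Ω y ζ₂) {s : ℝ} (hs : s ∈ flightTimes Ω x ζ₁) :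
    |velocityIntegral γ β Ω f (x - s • ζ₁) ζ₁ - velocityIntegral γ β Ω f (y - s • ζ₂) ζ₂|
      ≤ holderConstG H A M D ν₀ L * ((1 + s) * ((1 - s / (tauMinus Ω x ζ₁).toReal) ^ (-σ)
        * ((‖x - y‖ + ‖ζ₁ - ζ₂‖) * (1 + d⁻¹)) ^ σ)) := by
  have hs2 := flightTimes_mono hτ hs
  have hu0 := one_sub_div_pos hs
  have hb1 := ball_sub_smul_subset S.domain.isOpen S.domain.isBounded S.domain.convex hx hxd
    hs.1.le hs.2.le
  have hb2 := (Metric.ball_subset_ball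
    (mul_le_mul_of_nonneg_right (one_sub_div_le hτ hs) hd.le)).trans
      (ball_sub_smul_subset S.domain.isOpen S.domain.isBounded S.domain.convex hy hyd
        hs2.1.le hs2.2.le)
  have h := S.abs_velocityIntegral_sub_le (ζ₁ := ζ₁) (ζ₂ := ζ₂) (mul_pos hu0 hd)
    (S.mem_of_flightTimes hx hs) (S.mem_of_flightTimes hy hs2) hb1 hb2
  refine h.trans (mul_le_mul_of_nonneg_left ?_ S.holderConstG_nonneg)
  have hu1 : 1 - s / (tauMinus Ω x ζ₁).toReal ≤ 1 := by
    have := div_nonneg hs.1.le (tauMinus Ω x ζ₁).toReal_nonneg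
    linarith
  exact scaled_holder_le hd S.σ_pos.le S.σ_lt.le hs.1.le hu0 hu1 (by positivity) (by positivity)
    (norm_trajectory_sub_le hs.1.le)

theorem abs_flightIntegrand_sub_le (S : Setting γ β Ω f H A M σ D ν₀ L) (hd : 0 < d)
    (hx : x ∈ Ω) (hy : y ∈ Ω) (hxd : Metric.ball x d ⊆ Ω) (hyd : Metric.ball y d ⊆ Ω)
    (hτ : tauMinus Ω x ζ₁ ≤ tauMinus Ω y ζ₂) {s : ℝ} (hs : s ∈ flightTimes Ω x ζ₁) :
    |flightIntegrand γ β Ω f x ζ₁ s - flightIntegrand γ β Ω f y ζ₂ s|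
      ≤ ((holderConstG H A M D ν₀ L + (1 + L) * (A * ∫ v, H v)) * (1 + (ν₀ / 2)⁻¹)
          * ((‖x - y‖ + ‖ζ₁ - ζ₂‖) * (1 + d⁻¹)) ^ σ)
        * decayMajorant (ν₀ / 2) σ (tauMinus Ω x ζ₁).toReal s := by
  have hs0 : 0 ≤ s := hs.1.le
  have hν₀ := S.frequency.pos
  have hdd : 0 < d⁻¹ := inv_pos.2 hd
  have hC := S.holderConstG_nonneg
  have hL := S.L_nonneg
  have hAH : 0 ≤ A * ∫ v, H v := mul_nonneg S.A_nonneg S.integral_H_nonneg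
  have hδ0 : 0 ≤ ‖x - y‖ + ‖ζ₁ - ζ₂‖ := by positivity
  have hu0 := one_sub_div_pos hs
  have hu1 : 1 - s / (tauMinus Ω x ζ₁).toReal ≤ 1 := by
    have := div_nonneg hs0 (tauMinus Ω x ζ₁).toReal_nonneg
    linarith
  have hup : 1 ≤ (1 - s / (tauMinus Ω x ζ₁).toReal) ^ (-σ) :=
    Real.one_le_rpow_of_pos_of_le_one_of_nonpos hu0 hu1 (by linarith [S.σ_pos])
  have hmaj := le_decayMajorant (half_pos hν₀) S.σ_pos.le S.σ_lt.le hs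
  have hG := S.abs_velocityIntegral_flight_sub_le hd hx hy hxd hyd hτ hs
  have hG1 := S.abs_velocityIntegral_le (S.mem_of_flightTimes hx hs) ζ₁
  have hE := holder_frequency_part S.frequency hL S.σ_pos.le S.σ_lt.le hs0
    (show ‖ζ₁ - ζ₂‖ ≤ ‖x - y‖ + ‖ζ₁ - ζ₂‖ by linarith [norm_nonneg (x - y)])
  have hE2 : Real.exp (-(nu γ β ζ₂ * s)) ≤ Real.exp (-(ν₀ * s)) := by
    have := S.frequency.lower ζ₂
    gcongr
  have hδQ : (‖x - y‖ + ‖ζ₁ - ζ₂‖) ^ σ ≤ ((‖x - y‖ + ‖ζ₁ - ζ₂‖) * (1 + d⁻¹)) ^ σ :=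
    Real.rpow_le_rpow hδ0 (by nlinarith) S.σ_pos.le
  have hQ0 : 0 ≤ ((‖x - y‖ + ‖ζ₁ - ζ₂‖) * (1 + d⁻¹)) ^ σ := by positivity
  have hexp := one_add_mul_exp_le_mul_exp hν₀ hs0
  have hB : 0 ≤ (ν₀ / 2)⁻¹ := by positivity
  have he0 := Real.exp_pos (-(nu γ β ζ₂ * s))
  rw [flightIntegrand, flightIntegrand]
  generalize ((‖x - y‖ + ‖ζ₁ - ζ₂‖) * (1 + d⁻¹)) ^ σ = Q at hG hδQ hQ0 ⊢
  generalize (‖x - y‖ + ‖ζ₁ - ζ₂‖) ^ σ = P at hE hδQ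
  generalize decayMajorant (ν₀ / 2) σ (tauMinus Ω x ζ₁).toReal s = m at hmaj ⊢
  generalize (1 - s / (tauMinus Ω x ζ₁).toReal) ^ (-σ) = u at hG hup hmaj
  generalize velocityIntegral γ β Ω f (x - s • ζ₁) ζ₁ = g₁ at hG hG1 ⊢
  generalize velocityIntegral γ β Ω f (y - s • ζ₂) ζ₂ = g₂ at hG ⊢
  generalize Real.exp (-(nu γ β ζ₁ * s)) = e₁ at hE ⊢
  generalize Real.exp (-(nu γ β ζ₂ * s)) = e₂ at hE hE2 he0 ⊢
  generalize A * ∫ v, H v = K at hG1 hAH ⊢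
  generalize holderConstG H A M D ν₀ L = C at hG hC ⊢
  -- The frequency term has no singularity at the end of the flight. Inserting the factor `u ≥ 1`
  -- lets one majorant serve both terms.
  have hPu : P ≤ u * Q := hδQ.trans (le_mul_of_one_le_left hQ0 hup)
  have hE' : |e₁ - e₂| ≤ Real.exp (-(ν₀ * s)) * ((1 + L) * (1 + s) * (u * Q)) :=
    hE.trans (by gcongr)
  have hu : 0 ≤ u := zero_le_one.trans hup
  calc |e₁ * g₁ - e₂ * g₂| = |(e₁ - e₂) * g₁ + e₂ * (g₁ - g₂)| := by congr 1; ring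
    _ ≤ |e₁ - e₂| * |g₁| + e₂ * |g₁ - g₂| := by
      refine (abs_add_le _ _).trans (le_of_eq ?_)
      rw [abs_mul, abs_mul, abs_of_pos he0]
    _ ≤ (Real.exp (-(ν₀ * s)) * ((1 + L) * (1 + s) * (u * Q))) * K
        + Real.exp (-(ν₀ * s)) * (C * ((1 + s) * (u * Q))) := by gcongr
    _ = (C + (1 + L) * K) * ((1 + s) * Real.exp (-(ν₀ * s))) * u * Q := by ring
    _ ≤ (C + (1 + L) * K) * ((1 + (ν₀ / 2)⁻¹) * Real.exp (-(ν₀ / 2 * s))) * u * Q := by gcongr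
    _ = ((C + (1 + L) * K) * (1 + (ν₀ / 2)⁻¹) * Q) * (Real.exp (-(ν₀ / 2 * s)) * u) := by ring
    _ ≤ _ := by gcongr

/-- The Hölder constant of `II`. -/
noncomputable def holderConstII (H : E3 → ℝ) (A M σ D ν₀ L : ℝ) : ℝ :=
  (holderConstG H A M D ν₀ L + (1 + L) * (A * ∫ v, H v)) * (1 + (ν₀ / 2)⁻¹)
      * (2 / (ν₀ / 2) + 2 / (ν₀ / 2 * (1 - σ)))
    + A * (∫ v, H v) * (4 * (1 + (ν₀ / 2)⁻¹) / ν₀)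

theorem holderConstII_nonneg (S : Setting γ β Ω f H A M σ D ν₀ L) :
    0 ≤ holderConstII H A M σ D ν₀ L := by
  have h1 := S.holderConstG_nonneg
  have h2 := S.A_nonneg
  have h3 := S.integral_H_nonneg
  have h4 := S.L_nonneg
  have h5 := S.frequency.pos
  have h6 : 0 < 1 - σ := sub_pos.2 S.σ_lt
  unfold holderConstII
  positivity

/-- With the shorter flight named first, the longer time integral is cut at its end. The common
times are controlled by the decay majorant and the surplus by the tail estimate. -/
theorem abs_termII_sub_le (S : Setting γ β Ω f H A M σ D ν₀ L) (hd : 0 < d)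
    (hx : x ∈ Ω) (hy : y ∈ Ω) (hxd : Metric.ball x d ⊆ Ω) (hyd : Metric.ball y d ⊆ Ω) :
    |termII γ β Ω f x ζ₁ - termII γ β Ω f y ζ₂|
      ≤ holderConstII H A M σ D ν₀ L * ((‖x - y‖ + ‖ζ₁ - ζ₂‖) * (1 + d⁻¹)) ^ σ := by
  wlog hτ : tauMinus Ω x ζ₁ ≤ tauMinus Ω y ζ₂ generalizing x y ζ₁ ζ₂
  · rw [abs_sub_comm, norm_sub_rev x, norm_sub_rev ζ₁]
    exact this hy hx hyd hxd (le_of_not_ge hτ)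
  have hdd : 0 < d⁻¹ := inv_pos.2 hd
  have hi1 := S.integrableOn_flightIntegrand hx ζ₁
  have hi2 := S.integrableOn_flightIntegrand hy ζ₂
  have hsub := flightTimes_mono hτ
  have hm := measurableSet_flightTimes Ω x ζ₁
  have htail := S.abs_tail_le hd hy hyd hτ
  obtain ⟨hmi, hmint⟩ := integrableOn_decayMajorant (Ω := Ω) (x := x) (ζ := ζ₁)
    (half_pos S.frequency.pos) S.σ_lt
  have hmain : |∫ s in flightTimes Ω x ζ₁,
      (flightIntegrand γ β Ω f x ζ₁ s - flightIntegrand γ β Ω f y ζ₂ s)|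
      ≤ ((holderConstG H A M D ν₀ L + (1 + L) * (A * ∫ v, H v)) * (1 + (ν₀ / 2)⁻¹)
          * ((‖x - y‖ + ‖ζ₁ - ζ₂‖) * (1 + d⁻¹)) ^ σ)
        * (2 / (ν₀ / 2) + 2 / (ν₀ / 2 * (1 - σ))) := by
    rw [← Real.norm_eq_abs]
    refine (norm_integral_le_of_norm_le (hmi.const_mul
      ((holderConstG H A M D ν₀ L + (1 + L) * (A * ∫ v, H v)) * (1 + (ν₀ / 2)⁻¹)
          * ((‖x - y‖ + ‖ζ₁ - ζ₂‖) * (1 + d⁻¹)) ^ σ)) ?_).trans ?_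
    · filter_upwards [ae_restrict_mem hm] with s hs
      exact S.abs_flightIntegrand_sub_le hd hx hy hxd hyd hτ hs
    · rw [integral_const_mul]
      refine mul_le_mul_of_nonneg_left hmint ?_
      have h1 := S.holderConstG_nonneg
      have h2 := S.A_nonneg
      have h3 := S.integral_H_nonneg
      have h4 := S.L_nonneg
      have h5 := S.frequency.pos
      positivity
  have hdec : termII γ β Ω f x ζ₁ - termII γ β Ω f y ζ₂
      = (∫ s in flightTimes Ω x ζ₁,
          (flightIntegrand γ β Ω f x ζ₁ s - flightIntegrand γ β Ω f y ζ₂ s))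
        - ∫ s in flightTimes Ω y ζ₂ \ flightTimes Ω x ζ₁, flightIntegrand γ β Ω f y ζ₂ s := by
    rw [termII_eq, termII_eq, setIntegral_sdiff hm hi2 hsub,
      integral_sub hi1 (hi2.mono_set hsub)]
    ring
  rw [hdec]
  refine (abs_sub _ _).trans ((add_le_add hmain htail).trans (le_of_eq ?_))
  rw [holderConstII]
  ring

end Setting

/-! ### Diameter bound and final assembly -/

theorem exists_isConvexDomain (hΩo : IsOpen Ω) (hΩb : Bornology.IsBounded Ω)
    (hΩc : Convex ℝ Ω) (hΩ1 : HasC1Boundary Ω) : ∃ D, 0 ≤ D ∧ IsConvexDomain Ω D := by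
  obtain ⟨R, hR⟩ := hΩb.closure.exists_norm_le
  refine ⟨2 * |R|, by positivity, hΩo, hΩb, hΩc, hΩ1, fun a ha b hb => ?_⟩
  have h1 := hR a ha
  have h2 := hR b hb
  have h3 := le_abs_self R
  exact (norm_sub_le _ _).trans (by linarith)

end LinBoltzmann

theorem mainTheorem6
    (γ : ℝ) (hγ0 : 0 ≤ γ) (hγ1 : γ < 1)
    (β : ℝ → ℝ) (hβ : LinBoltzmann.IsCutoffAngular β)
    (Ω : Set LinBoltzmann.E3) (hΩo : IsOpen Ω) (hΩb : Bornology.IsBounded Ω)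
    (hΩc : Convex ℝ Ω) (hΩ1 : LinBoltzmann.HasC1Boundary Ω)
    (σ : ℝ) (hσ0 : 0 < σ) (hσ1 : σ < 1 / 2)
    (A M : ℝ) :
    ∃ C₁₀ : ℝ, ∀ f : LinBoltzmann.E3 → LinBoltzmann.E3 → ℝ,
      (∀ q ∈ LinBoltzmann.incoming Ω, |f q.1 q.2| ≤ A) →
      (∀ q ∈ LinBoltzmann.incoming Ω, ∀ r ∈ LinBoltzmann.incoming Ω,
        |f q.1 q.2 - f r.1 r.2|
          ≤ M * (‖q.1 - r.1‖ ^ 2 + ‖q.2 - r.2‖ ^ 2) ^ (σ / 2)) →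
      (∀ x ∈ Ω, ∀ ζ : LinBoltzmann.E3,
        MeasureTheory.Integrable
          (fun q : ℝ × LinBoltzmann.E3 => LinBoltzmann.integrandII γ β Ω f x ζ q.1 q.2)
          ((MeasureTheory.volume.restrict (LinBoltzmann.flightTimes Ω x ζ)).prod
            MeasureTheory.volume)) ∧
      (∀ x ∈ Ω, ∀ y ∈ Ω, ∀ ζ₁ ζ₂ : LinBoltzmann.E3,
        |LinBoltzmann.termII γ β Ω f x ζ₁ - LinBoltzmann.termII γ β Ω f y ζ₂|
          ≤ C₁₀ * (1 + (LinBoltzmann.boundaryDist Ω x y)⁻¹) ^ 3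
            * (‖x - y‖ ^ 2 + ‖ζ₁ - ζ₂‖ ^ 2) ^ (σ / 2)) := by
  obtain ⟨D, hD, hΩ⟩ := LinBoltzmann.exists_isConvexDomain hΩo hΩb hΩc hΩ1
  obtain ⟨ν₀, L, hL, hν⟩ := LinBoltzmann.exists_isFrequency_nu hβ hγ0 hγ1.le
  obtain ⟨H, hH⟩ := LinBoltzmann.exists_isTranslationKernel_collisionKernel hβ hγ0 hγ1.le
  -- Absolute values appear because no sign is imposed on `A` and `M`. The factor `2` pays for
  -- passing from the sum of the two distances to the Euclidean distance in phase space.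
  refine ⟨LinBoltzmann.Setting.holderConstII H |A| |M| σ D ν₀ L * 2, fun f hf1 hf2 => ?_⟩
  have hf : LinBoltzmann.IsHolderData Ω |A| |M| σ f :=
    ⟨fun q hq => (hf1 q hq).trans (le_abs_self A), fun q hq r hr => (hf2 q hq r hr).trans
      (mul_le_mul_of_nonneg_right (le_abs_self M) (by positivity))⟩
  have S : LinBoltzmann.Setting γ β Ω f H |A| |M| σ D ν₀ L :=
    ⟨hΩ, hν, hf, hH, abs_nonneg _, abs_nonneg _, hD, hL, hσ0, by linarith⟩
  refine ⟨fun x hx ζ => S.integrable_integrandII hx ζ, fun x hx y hy ζ₁ ζ₂ => ?_⟩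
  have hd : 0 < LinBoltzmann.boundaryDist Ω x y :=
    lt_min (LinBoltzmann.infDist_frontier_pos hΩo hΩb hx)
      (LinBoltzmann.infDist_frontier_pos hΩo hΩb hy)
  have hxd : Metric.ball x (LinBoltzmann.boundaryDist Ω x y) ⊆ Ω :=
    (Metric.ball_subset_ball (min_le_left _ _)).trans
      (LinBoltzmann.ball_infDist_frontier_subset hΩo hx)
  have hyd : Metric.ball y (LinBoltzmann.boundaryDist Ω x y) ⊆ Ω :=
    (Metric.ball_subset_ball (min_le_right _ _)).trans
      (LinBoltzmann.ball_infDist_frontier_subset hΩo hy)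
  have h := S.abs_termII_sub_le (ζ₁ := ζ₁) (ζ₂ := ζ₂) hd hx hy hxd hyd
  have hC := S.holderConstII_nonneg
  have hdd := inv_pos.2 hd
  refine h.trans ?_
  rw [Real.mul_rpow (by positivity) (by positivity)]
  have h1 := LinBoltzmann.add_rpow_le_sq_add_sq (norm_nonneg (x - y)) (norm_nonneg (ζ₁ - ζ₂))
    hσ0.le (by linarith)
  have h2 : (1 + (LinBoltzmann.boundaryDist Ω x y)⁻¹) ^ σ
      ≤ (1 + (LinBoltzmann.boundaryDist Ω x y)⁻¹) ^ 3 := by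
    rw [← Real.rpow_natCast]
    exact Real.rpow_le_rpow_of_exponent_le (by linarith) (by push_cast; linarith)
  calc _ ≤ LinBoltzmann.Setting.holderConstII H |A| |M| σ D ν₀ L
        * ((2 * (‖x - y‖ ^ 2 + ‖ζ₁ - ζ₂‖ ^ 2) ^ (σ / 2))
          * (1 + (LinBoltzmann.boundaryDist Ω x y)⁻¹) ^ 3) := by gcongr
    _ = _ := by ring
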